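/- For a finite graph $G$ with $v_G\ge 3$ vertices and $e_G$ edges let $d_2(G)=\frac{e_G-1}{v_G-2}$ and let $m_2(G)=\max\{d_2(J): J\subseteq G,\ v_J\ge 3\}$. Call $G$ strictly 2-balanced if $v_G \ge 3$, $m_2(G)=d_2(G)$ and $m_2(G)>d_2(J)$ for every proper subgraph $J\subsetneq G$ with $v_J\ge 3$. Let $H$ be a finite graph. A copy of $H$ in a graph $K$ is a (not necessarily induced) subgraph of $K$ isomorphic to $H$. An edge of $K$ is open (with respect to $K$) if it lies in exactly one copy of $H$ in $K$. A copy of $H$ in $K$ is unproblematic if it contains at least two open edges of $K$, and problematic otherwise. The $H$-core of a graph $G$ is the inclusion-maximal subgraph $K\subseteq G$ (there is exactly one for $H$ as in the lemma) such that every edge of $K$ lies in a copy of $H$ in $K$ and every copy of $H$ in $K$ is problematic. A subgraph $F$ of the $H$-core $K$ is $H$-closed if every copy of $H$ in $K$ is either contained in $F$ or edge-disjoint from $F$; a minimal $H$-closed subgraph is an inclusion-minimal one among the $H$-closed subgraphs having at least one edge. Lemma. Let $H$ be a strictly 2-balanced finite graph that is neither a forest nor a triangle. Then there are constants $c>0$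 and $L>0$, depending only on $H$, such that for every sequence $p=p(n)\in[0,1]$ with $p(n)\le c\,n^{-1/m_2(H)}$ for all sufficiently large $n$, the probability that every minimal $H$-closed subgraph of the $H$-core of the binomial random graph $G_{n,p}$ has at most $L$ vertices tends to $1$ as $n\to\infty$. -/

import Mathlib

namespace HCore

/-- The quantity `d₂(G) = (|E| - 1) / (|V| - 2)`, for a finite graph `G` on at least three
vertices. -/
noncomputable def d2 {W : Type*} (G : SimpleGraph W) : ℝ :=
  ((G.edgeSet.ncard : ℝ) - 1) / ((Nat.card W : ℝ) - 2)

/-- The 2-density `m₂(G)`: the maximum of `d₂(J)` over the subgraphs `J` of `G` with at least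
three vertices (a finite, nonempty family if `G` is finite with at least three vertices). -/
noncomputable def m2 {W : Type*} (G : SimpleGraph W) : ℝ :=
  sSup {x : ℝ | ∃ J : G.Subgraph, 3 ≤ J.verts.ncard ∧ x = d2 J.coe}

/-- `G` has at least three vertices, `m₂(G) = d₂(G)`, and `d₂(J) < m₂(G)` for every proper
subgraph `J` of `G` with at least three vertices. -/
def IsStrictlyTwoBalanced {W : Type*} (G : SimpleGraph W) : Prop :=
  3 ≤ Nat.card W ∧ m2 G = d2 G ∧
    ∀ J : G.Subgraph, J ≠ ⊤ → 3 ≤ J.verts.ncard → d2 J.coe < m2 G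

variable {W V : Type*} (H : SimpleGraph W) {G : SimpleGraph V}

/-- `J` is a copy of `H` in the subgraph `K` of `G`: a (not necessarily induced) subgraph of `K`
that is isomorphic to `H`. -/
def IsCopyIn (K J : G.Subgraph) : Prop :=
  J ≤ K ∧ Nonempty (H ≃g J.coe)

/-- The edge `e` is open with respect to `K`: it lies in exactly one copy of `H` in `K`. -/
def IsOpenEdge (K : G.Subgraph) (e : Sym2 V) : Prop :=
  ∃! J : G.Subgraph, IsCopyIn H K J ∧ e ∈ J.edgeSet

/-- The copy `J` of `H` in `K` is unproblematic: it contains at least two edges that are open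
with respect to `K`. -/
def IsUnproblematic (K J : G.Subgraph) : Prop :=
  ∃ e ∈ J.edgeSet, ∃ f ∈ J.edgeSet, e ≠ f ∧ IsOpenEdge H K e ∧ IsOpenEdge H K f

/-- `K` is an `H`-core of `G`: an inclusion-maximal subgraph of `G` such that every edge of `K`
lies in a copy of `H` in `K`, and every copy of `H` in `K` is problematic. -/
def IsHCore (K : G.Subgraph) : Prop :=
  Maximal (fun K' : G.Subgraph =>
    (∀ e ∈ K'.edgeSet, ∃ J, IsCopyIn H K' J ∧ e ∈ J.edgeSet) ∧
    (∀ J, IsCopyIn H K' J → ¬ IsUnproblematic H K' J)) K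

/-- `F` is an `H`-closed subgraph of `K` (in the application `K` is the `H`-core): every copy of
`H` in `K` is contained in `F` or edge-disjoint from `F`. -/
def IsHClosed (K F : G.Subgraph) : Prop :=
  F ≤ K ∧ ∀ J, IsCopyIn H K J → J ≤ F ∨ Disjoint J.edgeSet F.edgeSet

/-- `F` is inclusion-minimal among the `H`-closed subgraphs of `K` with at least one edge.
(These are the pieces into which the edges of the `H`-core are partitioned; a subgraph without
edges is always `H`-closed and has to be left out.) -/
def IsMinimalHClosed (K F : G.Subgraph) : Prop :=
  Minimal (fun F' : G.Subgraph => IsHClosed H K F' ∧ F'.edgeSet.Nonempty) F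

end HCore

/-! Let `H` have v vertices and e edges. A minimal closed subgraph `F` of the core is explored copy
by copy: each step adds an uncovered copy of `H` touching a new edge of the oldest step where this
is possible. A step is regular if its copy meets the old vertices in at most two vertices, hence
shares just one edge with the old graph; otherwise it is degenerate.

Deterministic half (`IsExploration.length_le`): a complete exploration is at most linearly longer
than its number of degenerate steps. By strict 2-balancedness, gluing a copy along one edge creates
no further copy (`TwoDense.glue`). So the at least e - 1 new edges of a regular copy stay open until
a later copy touches one of its inner vertices and kills it; since copies in the core are
problematic, each regular step is killed. A degenerate step kills at most v steps. A regular step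
kills at most one, and spoils only one of its edges; the oldest-first rule then makes the next step
return to the victim, so that it is degenerate or kills nothing. Counting gives the bound.

Probabilistic half (`hasContinuation_le`): the expected number of regular attachments to a given
copy is O(n^(v-2) p^(e-1)), a small constant for small c. Degenerate attachments cost n^(-1/(e-1))
up to powers of log n. The attachment indices never decrease, so they contribute only an exponential
factor. A first-moment bound thus rules out both explorations of length T of order log n and
explorations with D degenerate steps, D a large constant. Without these, every exploration of `F` is
complete with fewer than D degenerate steps, so `F` has bounded size. -/

open Finset MeasureTheory

namespace HCore

/-! ### Arithmetic of strict 2-balancedness -/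

/-- The arithmetic consequences of strict 2-balancedness, for a graph that is neither a forest nor
a triangle. -/
structure TwoDense {W : Type*} [Fintype W] (H : SimpleGraph W) [Fintype H.edgeSet] : Prop where
  four_le : 4 ≤ Fintype.card W
  card_le : Fintype.card W ≤ #H.edgeFinset
  cover : ∀ w, ∃ x ∈ H.edgeFinset, w ∈ x
  dens : ∀ (S : Finset W) (X : Finset (Sym2 W)), X ⊆ H.edgeFinset → (∀ x ∈ X, ∀ w ∈ x, w ∈ S) →
    3 ≤ #S → X ≠ H.edgeFinset →
    ((#H.edgeFinset : ℤ) - 1) * (Fintype.card W - #S) + 1 ≤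
      ((#H.edgeFinset : ℤ) - #X) * (Fintype.card W - 2)

lemma ncard_edgeSet_coe {W : Type*} {H : SimpleGraph W} (J : H.Subgraph) :
    J.coe.edgeSet.ncard = J.edgeSet.ncard := by
  rw [← SimpleGraph.Subgraph.image_coe_edgeSet_coe,
    Set.ncard_image_of_injective _ (Sym2.map.injective Subtype.coe_injective)]

lemma d2_coe {W : Type*} {H : SimpleGraph W} (J : H.Subgraph) :
    d2 J.coe = ((J.edgeSet.ncard : ℝ) - 1) / ((J.verts.ncard : ℝ) - 2) := by
  rw [d2, ncard_edgeSet_coe, Nat.card_coe_set_eq]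

/-- The subgraph with vertex set `S` and edge set `X`. -/
def subgraphOf {W : Type*} (H : SimpleGraph W) (S : Set W) (X : Set (Sym2 W))
    (hX : X ⊆ H.edgeSet) (hS : ∀ x ∈ X, ∀ w ∈ x, w ∈ S) : H.Subgraph where
  verts := S
  Adj a b := s(a, b) ∈ X
  adj_sub h := hX h
  edge_vert h := hS _ h _ (Sym2.mem_mk_left _ _)
  symm := ⟨fun a b h => by rwa [Sym2.eq_swap]⟩

lemma edgeSet_subgraphOf {W : Type*} (H : SimpleGraph W) (S : Set W) (X : Set (Sym2 W))
    (hX : X ⊆ H.edgeSet) (hS : ∀ x ∈ X, ∀ w ∈ x, w ∈ S) :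
    (subgraphOf H S X hX hS).edgeSet = X := by
  ext e
  induction e with
  | _ a b => rfl

lemma IsStrictlyTwoBalanced.edges_lt {W : Type*} [Finite W] {H : SimpleGraph W}
    (hbal : IsStrictlyTwoBalanced H) (J : H.Subgraph) (hJ : J ≠ ⊤) (h3 : 3 ≤ J.verts.ncard) :
    ((J.edgeSet.ncard : ℝ) - 1) * (Nat.card W - 2) <
      ((H.edgeSet.ncard : ℝ) - 1) * (J.verts.ncard - 2) := by
  obtain ⟨hW, hm, h⟩ := hbal
  have := h J hJ h3
  rw [hm, d2_coe, d2] at this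
  have h1 : (3 : ℝ) ≤ Nat.card W := by exact_mod_cast hW
  have h2 : (3 : ℝ) ≤ J.verts.ncard := by exact_mod_cast h3
  rwa [div_lt_div_iff₀ (by linarith) (by linarith)] at this

/-- A cycle of length l has `d2` equal to (l - 1)/(l - 2) > 1. Either it is all of `H`, or
balancedness forces the density of `H` above 1. -/
lemma IsStrictlyTwoBalanced.card_le {W : Type*} [Finite W] {H : SimpleGraph W}
    (hbal : IsStrictlyTwoBalanced H) (hforest : ¬ H.IsAcyclic) :
    Nat.card W ≤ H.edgeSet.ncard := by
  classical
  unfold SimpleGraph.IsAcyclic at hforest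
  push Not at hforest
  obtain ⟨u, c, hc⟩ := hforest
  set J := c.toSubgraph
  have hE : J.edgeSet.ncard = c.length := by
    have : J.edgeSet = (c.edges.toFinset : Set (Sym2 W)) := by
      ext x; simp [J]
    rw [this, Set.ncard_coe_finset, List.toFinset_card_of_nodup hc.edges_nodup]
    simp
  have hV : J.verts.ncard = c.length := by
    have : J.verts = (c.support.tail.toFinset : Set W) := by
      ext x
      have := SimpleGraph.Walk.mem_support_iff c (w := x)
      simp only [J, SimpleGraph.Walk.verts_toSubgraph, List.coe_toFinset, Set.mem_ofPred_eq]
      rw [this]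
      constructor
      · rintro (rfl | h)
        · exact SimpleGraph.Walk.end_mem_tail_support hc.not_nil
        · exact h
      · exact Or.inr
    rw [this, Set.ncard_coe_finset, List.toFinset_card_of_nodup hc.support_nodup]
    simp
  have h3 := hc.three_le_length
  have hW : 3 ≤ Nat.card W := hbal.1
  by_cases hJ : J = ⊤
  · rw [hJ] at hE hV
    have h1 : (⊤ : H.Subgraph).edgeSet = H.edgeSet := by simp
    have h2 : (⊤ : H.Subgraph).verts.ncard = Nat.card W := by simp [Set.ncard_univ]
    rw [h1] at hE
    omega
  · have := hbal.edges_lt J hJ (by omega)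
    rw [hE, hV] at this
    have h1 : (3 : ℝ) ≤ Nat.card W := by exact_mod_cast hW
    have h2 : (3 : ℝ) ≤ c.length := by exact_mod_cast h3
    by_contra! hcon
    have h4 : (H.edgeSet.ncard : ℝ) + 1 ≤ Nat.card W := by exact_mod_cast hcon
    nlinarith

lemma IsStrictlyTwoBalanced.four_le_card {W : Type*} [Finite W] {H : SimpleGraph W}
    (hbal : IsStrictlyTwoBalanced H) (hforest : ¬ H.IsAcyclic)
    (htriangle : ¬ Nonempty (H ≃g (⊤ : SimpleGraph (Fin 3)))) :
    4 ≤ Nat.card W := by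
  classical
  have hle := hbal.card_le hforest
  have h3 : 3 ≤ Nat.card W := hbal.1
  by_contra! hcon
  have hW : Nat.card W = 3 := by omega
  apply htriangle
  cases nonempty_fintype W
  have hF : Fintype.card W = 3 := by rw [← Nat.card_eq_fintype_card, hW]
  have htop : H = ⊤ := by
    have h1 : #H.edgeFinset = H.edgeSet.ncard := by
      rw [← SimpleGraph.coe_edgeFinset, Set.ncard_coe_finset]
    have h2 := SimpleGraph.card_edgeFinset_top_eq_card_choose_two (V := W)
    rw [hF] at h2
    rw [← SimpleGraph.edgeFinset_inj]
    refine Finset.eq_of_subset_of_card_le (SimpleGraph.edgeFinset_mono le_top) ?_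
    rw [h1, h2]
    simp [Nat.choose]
    omega
  subst htop
  exact ⟨SimpleGraph.Iso.completeGraph (Fintype.equivFinOfCardEq hF)⟩

lemma IsStrictlyTwoBalanced.twoDense {W : Type*} [Fintype W] {H : SimpleGraph W}
    [Fintype H.edgeSet] (hbal : IsStrictlyTwoBalanced H) (hforest : ¬ H.IsAcyclic)
    (htriangle : ¬ Nonempty (H ≃g (⊤ : SimpleGraph (Fin 3)))) : TwoDense H := by
  classical
  have h4 := hbal.four_le_card hforest htriangle
  have hle := hbal.card_le hforest
  have hW := Nat.card_eq_fintype_card (α := W)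
  have hE : H.edgeSet.ncard = #H.edgeFinset := by
    rw [← SimpleGraph.coe_edgeFinset, Set.ncard_coe_finset]
  have key : ∀ (S : Finset W) (X : Finset (Sym2 W)), X ⊆ H.edgeFinset →
      (∀ x ∈ X, ∀ w ∈ x, w ∈ S) → 3 ≤ #S → (X ≠ H.edgeFinset ∨ S ≠ univ) →
      ((#X : ℝ) - 1) * (Fintype.card W - 2) < ((#H.edgeFinset : ℝ) - 1) * (#S - 2) := by
    intro S X hX hS h3 hne
    have hX' : (X : Set (Sym2 W)) ⊆ H.edgeSet := fun x hx =>
      SimpleGraph.mem_edgeFinset.1 (hX hx)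
    have := hbal.edges_lt (subgraphOf H S X hX' (by simpa using hS)) ?_ ?_
    · rw [edgeSet_subgraphOf] at this
      simpa [subgraphOf, hE, hW, Set.ncard_coe_finset] using this
    · intro h
      rcases hne with hne | hne
      · apply hne
        have := congrArg SimpleGraph.Subgraph.edgeSet h
        rw [edgeSet_subgraphOf] at this
        apply Finset.coe_injective
        simpa using this
      · apply hne
        have := congrArg SimpleGraph.Subgraph.verts h
        apply Finset.coe_injective
        simpa [subgraphOf] using this
    · simpa [subgraphOf, Set.ncard_coe_finset] using h3
  refine ⟨by omega, by omega, ?_, ?_⟩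
  · intro w
    -- Deleting an isolated vertex would keep all edges and raise the density.
    by_contra! hcon
    have hc : #(univ.erase w) = Fintype.card W - 1 := by
      rw [card_erase_of_mem (mem_univ _), card_univ]
    have := key (univ.erase w) H.edgeFinset subset_rfl
      (fun x hx w' hw' => mem_erase.2 ⟨fun h => hcon x hx (h ▸ hw'), mem_univ _⟩)
      (by omega) (Or.inr (by simp))
    rw [hc, Nat.cast_sub (by omega)] at this
    have h5 : (4 : ℝ) ≤ #H.edgeFinset := by exact_mod_cast (by omega : 4 ≤ #H.edgeFinset)
    push_cast at this
    nlinarith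
  · intro S X hX hS h3 hne
    have := key S X hX hS h3 (Or.inl hne)
    -- A strict inequality between integers has a gap of 1; this gap later yields the factor
    -- n^(-1/(e-1)) for a degenerate step.
    have h' : ((#X : ℤ) - 1) * (Fintype.card W - 2) < ((#H.edgeFinset : ℤ) - 1) * (#S - 2) := by
      exact_mod_cast this
    nlinarith

/-! ### Copies as embeddings, and gluing along an edge -/

section Gluing

variable {W V : Type*}

lemma eq_mk_of_mem {x : Sym2 V} {a b : V} (hx : ¬ x.IsDiag)
    (h : ∀ w ∈ x, w = a ∨ w = b) : x = s(a, b) := by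
  induction x with
  | _ c d =>
    have hc := h c (Sym2.mem_mk_left _ _)
    have hd := h d (Sym2.mem_mk_right _ _)
    rw [Sym2.mk_isDiag_iff] at hx
    rw [Sym2.eq_iff]
    grind

variable {H : SimpleGraph W} [Fintype H.edgeSet]

variable (H) in
/-- The edge set of the copy of `H` that is the image of `φ`. -/
def copyEdges (φ : W ↪ V) : Finset (Sym2 V) := H.edgeFinset.map φ.sym2Map

lemma mem_copyEdges {φ : W ↪ V} {x : Sym2 V} :
    x ∈ copyEdges H φ ↔ ∃ y ∈ H.edgeFinset, y.map φ = x := by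
  simp [copyEdges]

@[simp] lemma card_copyEdges (φ : W ↪ V) : #(copyEdges H φ) = #H.edgeFinset := card_map _

lemma not_isDiag_of_mem_copyEdges {φ : W ↪ V} {x : Sym2 V} (hx : x ∈ copyEdges H φ) :
    ¬ x.IsDiag := by
  obtain ⟨y, hy, rfl⟩ := mem_copyEdges.1 hx
  rw [Sym2.isDiag_map φ.injective]
  exact H.not_isDiag_of_mem_edgeFinset hy

variable [Fintype W]

/-- The vertex set of the copy of `H` that is the image of `φ`. -/
def copyVerts (φ : W ↪ V) : Finset V := univ.map φ

lemma mem_copyVerts {φ : W ↪ V} {x : V} : x ∈ copyVerts φ ↔ ∃ w, φ w = x := by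
  simp [copyVerts]

@[simp] lemma card_copyVerts (φ : W ↪ V) : #(copyVerts φ) = Fintype.card W := by
  simp [copyVerts]

lemma mem_copyVerts_of_mem {φ : W ↪ V} {x : Sym2 V} (hx : x ∈ copyEdges H φ) {w : V}
    (hw : w ∈ x) : w ∈ copyVerts φ := by
  obtain ⟨y, -, rfl⟩ := mem_copyEdges.1 hx
  obtain ⟨u, -, rfl⟩ := Sym2.mem_map.1 hw
  exact mem_copyVerts.2 ⟨u, rfl⟩

lemma TwoDense.dens_copy (hH : TwoDense H) (φ : W ↪ V) {U : Finset V} {X : Finset (Sym2 V)}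
    (hU : U ⊆ copyVerts φ) (hX : X ⊆ copyEdges H φ) (hXU : ∀ x ∈ X, ∀ w ∈ x, w ∈ U)
    (h3 : 3 ≤ #U) (hne : X ≠ copyEdges H φ) :
    ((#H.edgeFinset : ℤ) - 1) * (Fintype.card W - #U) + 1 ≤
      ((#H.edgeFinset : ℤ) - #X) * (Fintype.card W - 2) := by
  obtain ⟨S, -, rfl⟩ := subset_map_iff.1 hU
  obtain ⟨Y, hY, rfl⟩ := subset_map_iff.1 hX
  rw [card_map] at h3 ⊢
  rw [card_map]
  refine hH.dens S Y hY ?_ h3 ?_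
  · intro x hx w hw
    have := hXU (x.map φ) (mem_map.2 ⟨x, hx, rfl⟩) (φ w) (Sym2.mem_map.2 ⟨w, hw, rfl⟩)
    simpa using this
  · rintro rfl
    exact hne rfl

variable [DecidableEq V]

/-- The vertices covered by a set of edges. -/
def edgeVerts (A : Finset (Sym2 V)) : Finset V := A.biUnion Sym2.toFinset

/-- The image of `φ` meets the edge set `A` in at most two vertices. -/
def IsRegular (A : Finset (Sym2 V)) (φ : W ↪ V) : Prop := #(copyVerts φ ∩ edgeVerts A) ≤ 2

lemma mem_edgeVerts {A : Finset (Sym2 V)} {w : V} : w ∈ edgeVerts A ↔ ∃ x ∈ A, w ∈ x := by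
  simp [edgeVerts]

lemma edgeVerts_mono {A B : Finset (Sym2 V)} (h : A ⊆ B) : edgeVerts A ⊆ edgeVerts B :=
  biUnion_subset_biUnion_of_subset_left _ h

lemma TwoDense.edgeVerts_copyEdges (hH : TwoDense H) (φ : W ↪ V) :
    edgeVerts (copyEdges H φ) = copyVerts φ := by
  ext w
  rw [mem_edgeVerts]
  constructor
  · rintro ⟨x, hx, hw⟩
    exact mem_copyVerts_of_mem hx hw
  · intro hw
    obtain ⟨u, rfl⟩ := mem_copyVerts.1 hw
    obtain ⟨y, hy, hu⟩ := hH.cover u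
    exact ⟨_, mem_copyEdges.2 ⟨y, hy, rfl⟩, Sym2.mem_map.2 ⟨u, hu, rfl⟩⟩

lemma card_le_one_of_verts {X : Finset (Sym2 V)} {U : Finset V} (hd : ∀ x ∈ X, ¬ x.IsDiag)
    (hU : ∀ x ∈ X, ∀ w ∈ x, w ∈ U) (h2 : #U ≤ 2) : #X ≤ 1 := by
  rw [card_le_one]
  intro x hx y hy
  induction x with
  | _ a b =>
    have hab : a ≠ b := by simpa using hd _ hx
    have ha := hU _ hx a (Sym2.mem_mk_left _ _)
    have hb := hU _ hx b (Sym2.mem_mk_right _ _)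
    have hUeq : ({a, b} : Finset V) = U :=
      eq_of_subset_of_card_le (by grind) (by rw [card_pair hab]; exact h2)
    refine (eq_mk_of_mem (hd _ hy) fun w hw => ?_).symm
    have := hU _ hy w hw
    rw [← hUeq] at this
    simpa using this

lemma two_le_card_edgeVerts {X : Finset (Sym2 V)} (hd : ∀ x ∈ X, ¬ x.IsDiag)
    (hne : X.Nonempty) : 2 ≤ #(edgeVerts X) := by
  obtain ⟨x, hx⟩ := hne
  have hsub : x.toFinset ⊆ edgeVerts X := fun w hw =>
    mem_edgeVerts.2 ⟨x, hx, by simpa using hw⟩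
  rw [← Sym2.card_toFinset_of_not_isDiag x (hd x hx)]
  exact card_le_card hsub

lemma IsRegular.card_inter_le {A : Finset (Sym2 V)} {φ : W ↪ V} (h : IsRegular A φ) :
    #(copyEdges H φ ∩ A) ≤ 1 := by
  refine card_le_one_of_verts (U := copyVerts φ ∩ edgeVerts A)
    (fun x hx => not_isDiag_of_mem_copyEdges (mem_inter.1 hx).1) (fun x hx w hw => ?_) h
  rw [mem_inter] at hx ⊢
  exact ⟨mem_copyVerts_of_mem hx.1 hw, mem_edgeVerts.2 ⟨x, hx.2, hw⟩⟩

/-- The gap of 1 is given up so that a single edge, where equality holds, is included. -/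
lemma TwoDense.dens_edgeVerts (hH : TwoDense H) (φ : W ↪ V) {X : Finset (Sym2 V)}
    (hX : X ⊆ copyEdges H φ) (hne : X.Nonempty) (hne' : X ≠ copyEdges H φ) :
    ((#H.edgeFinset : ℤ) - 1) * (Fintype.card W - #(edgeVerts X)) ≤
      ((#H.edgeFinset : ℤ) - #X) * (Fintype.card W - 2) := by
  have hd : ∀ x ∈ X, ¬ x.IsDiag := fun x hx => not_isDiag_of_mem_copyEdges (hX hx)
  have hv : ∀ x ∈ X, ∀ w ∈ x, w ∈ edgeVerts X := fun x hx w hw => mem_edgeVerts.2 ⟨x, hx, hw⟩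
  have h2 := two_le_card_edgeVerts hd hne
  rcases h2.eq_or_lt with h | h
  · have h1 := card_le_one_of_verts hd hv h.ge
    have h4 := hH.four_le
    rw [← h]
    have h1' : (#X : ℤ) ≤ 1 := by exact_mod_cast h1
    have h4' : (4 : ℤ) ≤ Fintype.card W := by exact_mod_cast h4
    push_cast
    nlinarith
  · have := hH.dens_copy φ (U := edgeVerts X)
      (hH.edgeVerts_copyEdges φ ▸ edgeVerts_mono hX) hX hv h hne'
    linarith

/-- Gluing a copy of `H` to a graph along a single edge creates no other copy of `H`. -/
lemma TwoDense.glue (hH : TwoDense H) {A : Finset (Sym2 V)} {φ ψ : W ↪ V}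
    (hreg : IsRegular A φ) (htouch : ¬ Disjoint (copyEdges H φ) A)
    (hψ : copyEdges H ψ ⊆ A ∪ copyEdges H φ) :
    copyEdges H ψ ⊆ A ∨ copyEdges H ψ = copyEdges H φ := by
  rw [or_iff_not_imp_left]
  intro hA
  suffices hB : copyEdges H ψ ⊆ copyEdges H φ from eq_of_subset_of_card_le hB (by simp)
  by_contra hB
  obtain ⟨f, hfφ, hfA⟩ := not_disjoint_iff.1 htouch
  obtain ⟨a, b, rfl⟩ : ∃ a b, f = s(a, b) := by
    induction f with
    | _ a b => exact ⟨a, b, rfl⟩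
  have hab : a ≠ b := by simpa using not_isDiag_of_mem_copyEdges hfφ
  -- Regularity leaves no room for common vertices beyond the ends of one shared edge.
  have hU : ({a, b} : Finset V) = copyVerts φ ∩ edgeVerts A := by
    refine eq_of_subset_of_card_le ?_ (by rw [card_pair hab]; exact hreg)
    intro w hw
    have hw' : w ∈ s(a, b) := by simpa using hw
    exact mem_inter.2 ⟨mem_copyVerts_of_mem hfφ hw', mem_edgeVerts.2 ⟨_, hfA, hw'⟩⟩
  set P := copyEdges H ψ with hP
  set B := copyEdges H φ with hBdef
  have hdP : ∀ x ∈ P, ¬ x.IsDiag := fun x hx => not_isDiag_of_mem_copyEdges hx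
  obtain ⟨x, hxP, hxA⟩ := not_subset.1 hA
  obtain ⟨y, hyP, hyB⟩ := not_subset.1 hB
  have hxB : x ∈ B := (mem_union.1 (hψ hxP)).resolve_left hxA
  have hyA : y ∈ A := (mem_union.1 (hψ hyP)).resolve_right hyB
  have hunion : edgeVerts (P ∩ A) ∪ edgeVerts (P ∩ B) = copyVerts ψ := by
    rw [← hH.edgeVerts_copyEdges ψ]
    ext w
    simp only [mem_union, mem_edgeVerts]
    constructor
    · rintro (⟨z, hz, hw⟩ | ⟨z, hz, hw⟩) <;> exact ⟨z, (mem_inter.1 hz).1, hw⟩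
    · rintro ⟨z, hz, hw⟩
      rcases mem_union.1 (hψ hz) with h | h
      · exact Or.inl ⟨z, mem_inter.2 ⟨hz, h⟩, hw⟩
      · exact Or.inr ⟨z, mem_inter.2 ⟨hz, h⟩, hw⟩
  have hinter : edgeVerts (P ∩ A) ∩ edgeVerts (P ∩ B) ⊆ {a, b} := by
    rw [hU]
    intro w hw
    obtain ⟨h1, h2⟩ := mem_inter.1 hw
    refine mem_inter.2 ⟨?_, edgeVerts_mono inter_subset_right h1⟩
    rw [← hH.edgeVerts_copyEdges φ]
    exact edgeVerts_mono inter_subset_right h2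
  have hcard := card_union_add_card_inter (edgeVerts (P ∩ A)) (edgeVerts (P ∩ B))
  rw [hunion, card_copyVerts] at hcard
  have hcard' : (Fintype.card W : ℤ) + #(edgeVerts (P ∩ A) ∩ edgeVerts (P ∩ B)) =
      #(edgeVerts (P ∩ A)) + #(edgeVerts (P ∩ B)) := by exact_mod_cast hcard
  have h4 : (4 : ℤ) ≤ Fintype.card W := by exact_mod_cast hH.four_le
  have hve : (Fintype.card W : ℤ) ≤ #H.edgeFinset := by exact_mod_cast hH.card_le
  have hPA : P ∩ A ≠ P := fun h => hA (inter_eq_left.1 h)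
  have hPB : P ∩ B ≠ P := fun h => hB (inter_eq_left.1 h)
  -- Suppose that the copy has edges off both sides. If its two parts share at most one vertex,
  -- adding their density bounds gives (e-1)(v-1) ≤ e(v-2), that is e < v, which is false.
  by_cases hle : #(edgeVerts (P ∩ A) ∩ edgeVerts (P ∩ B)) ≤ 1
  · have hle' : (#(edgeVerts (P ∩ A) ∩ edgeVerts (P ∩ B)) : ℤ) ≤ 1 := by exact_mod_cast hle
    have d1 := hH.dens_edgeVerts ψ (X := P ∩ A) inter_subset_left ⟨y, mem_inter.2 ⟨hyP, hyA⟩⟩ hPA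
    have d2 := hH.dens_edgeVerts ψ (X := P ∩ B) inter_subset_left ⟨x, mem_inter.2 ⟨hxP, hxB⟩⟩ hPB
    have hsum : #H.edgeFinset ≤ #(P ∩ A) + #(P ∩ B) := by
      rw [← card_copyEdges (H := H) ψ]
      refine (card_le_card ?_).trans (card_union_le _ _)
      rw [← inter_union_distrib_left]
      exact subset_inter subset_rfl hψ
    have hsum' : (#H.edgeFinset : ℤ) ≤ #(P ∩ A) + #(P ∩ B) := by exact_mod_cast hsum
    nlinarith
  · have heq : edgeVerts (P ∩ A) ∩ edgeVerts (P ∩ B) = {a, b} :=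
      eq_of_subset_of_card_le hinter (by rw [card_pair hab]; omega)
    have hcard2 : #(edgeVerts (P ∩ A) ∩ edgeVerts (P ∩ B)) = 2 := by rw [heq, card_pair hab]
    have haA : ∀ w ∈ s(a, b), w ∈ edgeVerts (P ∩ A) := fun w hw =>
      (mem_inter.1 (heq.symm ▸ (by simpa using hw) :
        w ∈ edgeVerts (P ∩ A) ∩ edgeVerts (P ∩ B))).1
    have haB : ∀ w ∈ s(a, b), w ∈ edgeVerts (P ∩ B) := fun w hw =>
      (mem_inter.1 (heq.symm ▸ (by simpa using hw) :
        w ∈ edgeVerts (P ∩ A) ∩ edgeVerts (P ∩ B))).2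
    have three : ∀ (S : Finset V) (z : Sym2 V), z ∈ P → z ≠ s(a, b) → (∀ w ∈ z, w ∈ S) →
        (∀ w ∈ s(a, b), w ∈ S) → 3 ≤ #S := by
      intro S z hz hzf hzS habS
      by_contra! hlt
      have hS : ({a, b} : Finset V) = S :=
        eq_of_subset_of_card_le (fun w hw => habS w (by simpa using hw))
          (by rw [card_pair hab]; omega)
      refine hzf (eq_mk_of_mem (hdP z hz) fun w hw => ?_)
      have := hzS w hw
      rw [← hS] at this
      simpa using this
    have h3A : 3 ≤ #(edgeVerts (P ∩ A)) := three _ y hyP (fun h => hyB (h ▸ hfφ))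
      (fun w hw => mem_edgeVerts.2 ⟨y, mem_inter.2 ⟨hyP, hyA⟩, hw⟩) haA
    have h3B : 3 ≤ #(edgeVerts (P ∩ B)) := three _ x hxP (fun h => hxA (h ▸ hfA))
      (fun w hw => mem_edgeVerts.2 ⟨x, mem_inter.2 ⟨hxP, hxB⟩, hw⟩) haB
    have hvB : ∀ z ∈ insert s(a, b) (P ∩ B), ∀ w ∈ z, w ∈ edgeVerts (P ∩ B) := by
      intro z hz w hw
      rcases mem_insert.1 hz with rfl | hz
      · exact haB w hw
      · exact mem_edgeVerts.2 ⟨z, hz, hw⟩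
    have d1 := hH.dens_copy ψ (U := edgeVerts (P ∩ A)) (X := P ∩ A)
      (hunion ▸ subset_union_left) inter_subset_left
      (fun z hz w hw => mem_edgeVerts.2 ⟨z, hz, hw⟩) h3A hPA
    -- The edge ab need not lie in the copy `ψ`, but it lies in `φ`, so the second part together
    -- with ab is measured inside `φ`. The extra edge makes the two bounds add up to (e-1)(v-2) + 2
    -- ≤ (e-1)(v-2).
    have d2 := hH.dens_copy φ (U := edgeVerts (P ∩ B)) (X := insert s(a, b) (P ∩ B))
      (hH.edgeVerts_copyEdges φ ▸ edgeVerts_mono inter_subset_right)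
      (insert_subset hfφ inter_subset_right) hvB h3B (by
        intro h
        have : copyVerts φ ⊆ edgeVerts (P ∩ B) := by
          rw [← hH.edgeVerts_copyEdges φ, ← h]
          intro w hw
          obtain ⟨z, hz, hw⟩ := mem_edgeVerts.1 hw
          exact hvB z hz w hw
        have := card_le_card this
        rw [card_copyVerts] at this
        omega)
    have hsum : #H.edgeFinset + 1 ≤ #(P ∩ A) + #(insert s(a, b) (P ∩ B)) := by
      have h1 : P ⊆ (P ∩ A) ∪ (insert s(a, b) (P ∩ B)).erase s(a, b) := by
        intro z hz
        by_cases hzA : z ∈ A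
        · exact mem_union_left _ (mem_inter.2 ⟨hz, hzA⟩)
        · refine mem_union_right _ (mem_erase.2 ⟨fun h => hzA (h ▸ hfA), mem_insert_of_mem ?_⟩)
          exact mem_inter.2 ⟨hz, (mem_union.1 (hψ hz)).resolve_left hzA⟩
      have h2 := (card_le_card h1).trans (card_union_le _ _)
      rw [card_erase_of_mem (mem_insert_self _ _)] at h2
      have h5 : #P = #H.edgeFinset := card_copyEdges ψ
      have h3 : 0 < #(insert s(a, b) (P ∩ B)) := card_pos.2 (insert_nonempty _ _)
      omega
    have hsum' : (#H.edgeFinset : ℤ) + 1 ≤ #(P ∩ A) + #(insert s(a, b) (P ∩ B)) := by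
      exact_mod_cast hsum
    rw [hcard2] at hcard'
    push_cast at hcard'
    nlinarith

end Gluing

/-! ### Explorations and the count of their steps -/

section Exploration

variable {W V : Type*} [DecidableEq V] (H : SimpleGraph W) [Fintype H.edgeSet]

/-- The edges of the first `k` copies of a sequence. -/
def edgesBefore (φ : ℕ → W ↪ V) (k : ℕ) : Finset (Sym2 V) :=
  (range k).biUnion fun i => copyEdges H (φ i)

/-- The edges of the `j`-th copy of a sequence that are in no earlier one. -/
def newEdges (φ : ℕ → W ↪ V) (j : ℕ) : Finset (Sym2 V) :=
  copyEdges H (φ j) \ edgesBefore H φ j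

/-- `φ 0, …, φ (t - 1)` is an exploration of the family `𝒞` of copies of `H`: each step `k` adds a
copy that is not yet covered and contains a new edge of step `b k`, where `b k` is as small as
possible. -/
structure IsExploration (𝒞 : Set (W ↪ V)) (φ : ℕ → W ↪ V) (b : ℕ → ℕ) (t : ℕ) : Prop where
  one_le : 1 ≤ t
  mem : ∀ k < t, φ k ∈ 𝒞
  lt : ∀ k, 1 ≤ k → k < t → b k < k
  touch : ∀ k, 1 ≤ k → k < t → ¬ Disjoint (copyEdges H (φ k)) (newEdges H φ (b k))
  not_subset : ∀ k, 1 ≤ k → k < t → ¬ copyEdges H (φ k) ⊆ edgesBefore H φ k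
  finished : ∀ k, 1 ≤ k → k < t → ∀ j < b k, ∀ ψ ∈ 𝒞,
    ¬ Disjoint (copyEdges H ψ) (newEdges H φ j) → copyEdges H ψ ⊆ edgesBefore H φ k

variable {H}

lemma mem_edgesBefore {φ : ℕ → W ↪ V} {k : ℕ} {x : Sym2 V} :
    x ∈ edgesBefore H φ k ↔ ∃ i < k, x ∈ copyEdges H (φ i) := by
  simp [edgesBefore]

lemma edgesBefore_mono (φ : ℕ → W ↪ V) : Monotone (edgesBefore H φ) := fun _ _ h =>
  biUnion_subset_biUnion_of_subset_left _ (range_mono h)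

lemma edgesBefore_succ (φ : ℕ → W ↪ V) (k : ℕ) :
    edgesBefore H φ (k + 1) = edgesBefore H φ k ∪ copyEdges H (φ k) := by
  rw [edgesBefore, range_add_one, biUnion_insert, union_comm, edgesBefore]

lemma edgesBefore_congr {φ ψ : ℕ → W ↪ V} {k : ℕ} (h : ∀ i < k, φ i = ψ i) :
    edgesBefore H φ k = edgesBefore H ψ k :=
  biUnion_congr rfl fun i hi => by rw [h i (mem_range.1 hi)]

lemma edgesBefore_update_succ (s : ℕ → W ↪ V) (k : ℕ) (ψ : W ↪ V) :
    edgesBefore H (Function.update s k ψ) (k + 1) = edgesBefore H s k ∪ copyEdges H ψ := by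
  rw [edgesBefore_succ, Function.update_self, edgesBefore_congr (ψ := s)]
  exact fun i hi => Function.update_of_ne hi.ne _ _

lemma newEdges_congr {φ ψ : ℕ → W ↪ V} {k : ℕ} (h : ∀ i ≤ k, φ i = ψ i) :
    newEdges H φ k = newEdges H ψ k := by
  rw [newEdges, newEdges, h k le_rfl, edgesBefore_congr fun i hi => h i hi.le]

lemma newEdges_subset (φ : ℕ → W ↪ V) {j k : ℕ} (h : j < k) :
    newEdges H φ j ⊆ edgesBefore H φ k := fun _ hx =>
  mem_edgesBefore.2 ⟨j, h, (mem_sdiff.1 hx).1⟩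

lemma disjoint_newEdges (φ : ℕ → W ↪ V) {i j : ℕ} (h : i ≠ j) :
    Disjoint (newEdges H φ i) (newEdges H φ j) := by
  wlog hij : i < j generalizing i j
  · exact (this h.symm (by omega)).symm
  · exact disjoint_of_subset_left (newEdges_subset φ hij) disjoint_sdiff_self_right

lemma exists_mem_newEdges {φ : ℕ → W ↪ V} {k : ℕ} {x : Sym2 V} (hx : x ∈ edgesBefore H φ k) :
    ∃ j < k, x ∈ newEdges H φ j := by
  classical
  have hex := mem_edgesBefore.1 hx
  have hex' : ∃ i, x ∈ copyEdges H (φ i) := ⟨hex.choose, hex.choose_spec.2⟩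
  refine ⟨Nat.find hex', ?_, mem_sdiff.2 ⟨Nat.find_spec hex', fun h => ?_⟩⟩
  · obtain ⟨i, hi, hxi⟩ := hex
    exact (Nat.find_min' hex' hxi).trans_lt hi
  · obtain ⟨i, hi, hxi⟩ := mem_edgesBefore.1 h
    exact Nat.find_min hex' hi hxi

/-- An exploration that has not covered everything can be prolonged. -/
lemma IsExploration.exists_succ {𝒞 : Set (W ↪ V)} {φ : ℕ → W ↪ V} {b : ℕ → ℕ} {t : ℕ}
    (h : IsExploration H 𝒞 φ b t)
    (hne : ∃ ψ ∈ 𝒞, ¬ Disjoint (copyEdges H ψ) (edgesBefore H φ t) ∧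
      ¬ copyEdges H ψ ⊆ edgesBefore H φ t) :
    ∃ φ' b', IsExploration H 𝒞 φ' b' (t + 1) := by
  classical
  -- The least such j becomes the new pointer; its minimality is the field `finished` for the added
  -- step.
  have hex : ∃ j, ∃ ψ ∈ 𝒞, ¬ Disjoint (copyEdges H ψ) (newEdges H φ j) ∧
      ¬ copyEdges H ψ ⊆ edgesBefore H φ t ∧ j < t := by
    obtain ⟨ψ, hψ, hd, hs⟩ := hne
    obtain ⟨x, hx, hxt⟩ := not_disjoint_iff.1 hd
    obtain ⟨j, hj, hxj⟩ := exists_mem_newEdges hxt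
    exact ⟨j, ψ, hψ, not_disjoint_iff.2 ⟨x, hx, hxj⟩, hs, hj⟩
  obtain ⟨ψ, hψ, hd, hs, hj⟩ := Nat.find_spec hex
  have hmin := fun j => Nat.find_min hex (m := j)
  set j₀ := Nat.find hex
  have hφ : ∀ i < t, Function.update φ t ψ i = φ i := fun i hi =>
    Function.update_of_ne hi.ne _ _
  have hb : ∀ i < t, Function.update b t j₀ i = b i := fun i hi =>
    Function.update_of_ne hi.ne _ _
  have hE : ∀ k ≤ t, edgesBefore H (Function.update φ t ψ) k = edgesBefore H φ k := fun k hk =>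
    edgesBefore_congr fun i hi => hφ i (hi.trans_le hk)
  have hN : ∀ k < t, newEdges H (Function.update φ t ψ) k = newEdges H φ k := fun k hk =>
    newEdges_congr fun i hi => hφ i (hi.trans_lt hk)
  refine ⟨Function.update φ t ψ, Function.update b t j₀, by omega, ?_, ?_, ?_, ?_, ?_⟩
  · intro k hk
    rcases Nat.lt_succ_iff_lt_or_eq.1 hk with hk | rfl
    · rw [hφ k hk]; exact h.mem k hk
    · rwa [Function.update_self]
  · intro k h1 hk
    rcases Nat.lt_succ_iff_lt_or_eq.1 hk with hk | rfl
    · rw [hb k hk]; exact h.lt k h1 hk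
    · rwa [Function.update_self]
  · intro k h1 hk
    rcases Nat.lt_succ_iff_lt_or_eq.1 hk with hk | rfl
    · rw [hb k hk, hφ k hk, hN _ ((h.lt k h1 hk).trans hk)]; exact h.touch k h1 hk
    · rwa [Function.update_self, Function.update_self, hN _ hj]
  · intro k h1 hk
    rcases Nat.lt_succ_iff_lt_or_eq.1 hk with hk | rfl
    · rw [hφ k hk, hE k hk.le]; exact h.not_subset k h1 hk
    · rwa [Function.update_self, hE _ le_rfl]
  · intro k h1 hk j hjk χ hχ hχd
    rcases Nat.lt_succ_iff_lt_or_eq.1 hk with hk | rfl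
    · rw [hb k hk] at hjk
      rw [hN _ ((hjk.trans (h.lt k h1 hk)).trans hk)] at hχd
      rw [hE k hk.le]
      exact h.finished k h1 hk j hjk χ hχ hχd
    · rw [Function.update_self] at hjk
      rw [hN _ (hjk.trans hj)] at hχd
      rw [hE _ le_rfl]
      by_contra hcon
      exact hmin j hjk ⟨χ, hχ, hχd, hcon, hjk.trans hj⟩

/-- A family of copies that cannot be split into edge-disjoint parts has an exploration that
either covers the family or has any prescribed length. -/
lemma exists_exploration {𝒞 : Set (W ↪ V)} (hne : 𝒞.Nonempty) (hH : H.edgeFinset.Nonempty)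
    (hconn : ∀ X : Finset (Sym2 V), X.Nonempty →
      (∀ x ∈ X, ∃ ψ ∈ 𝒞, x ∈ copyEdges H ψ) →
      (∀ ψ ∈ 𝒞, copyEdges H ψ ⊆ X ∨ Disjoint (copyEdges H ψ) X) → ∀ ψ ∈ 𝒞, copyEdges H ψ ⊆ X)
    (T : ℕ) (hT : 1 ≤ T) :
    ∃ φ b t, t ≤ T ∧ IsExploration H 𝒞 φ b t ∧
      ((∀ ψ ∈ 𝒞, copyEdges H ψ ⊆ edgesBefore H φ t) ∨ t = T) := by
  induction T, hT using Nat.le_induction with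
  | base =>
    obtain ⟨ψ, hψ⟩ := hne
    exact ⟨fun _ => ψ, 0, 1, le_rfl, ⟨le_rfl, fun _ _ => hψ, fun k _ _ => by omega,
      fun k _ _ => by omega, fun k _ _ => by omega, fun k _ _ => by omega⟩, Or.inr rfl⟩
  | succ T hT ih =>
    obtain ⟨φ, b, t, htT, hexp, hcov | rfl⟩ := ih
    · exact ⟨φ, b, t, by omega, hexp, Or.inl hcov⟩
    · by_cases hcov : ∀ ψ ∈ 𝒞, copyEdges H ψ ⊆ edgesBefore H φ t
      · exact ⟨φ, b, t, by omega, hexp, Or.inl hcov⟩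
      · have hstep : ∃ ψ ∈ 𝒞, ¬ Disjoint (copyEdges H ψ) (edgesBefore H φ t) ∧
            ¬ copyEdges H ψ ⊆ edgesBefore H φ t := by
          by_contra! hcon
          -- With no copy left to add, the explored edges split the family, so they already cover
          -- it.
          refine hcov (hconn _ ?_ ?_ ?_)
          · obtain ⟨y, hy⟩ := hH
            exact ⟨_, mem_edgesBefore.2 ⟨0, hT, mem_copyEdges.2 ⟨y, hy, rfl⟩⟩⟩
          · intro x hx
            obtain ⟨i, hi, hxi⟩ := mem_edgesBefore.1 hx
            exact ⟨φ i, hexp.mem i hi, hxi⟩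
          · intro ψ hψ
            by_cases hd : Disjoint (copyEdges H ψ) (edgesBefore H φ t)
            · exact Or.inr hd
            · exact Or.inl (hcon ψ hψ hd)
        obtain ⟨φ', b', h'⟩ := hexp.exists_succ hstep
        exact ⟨φ', b', t + 1, le_rfl, h', Or.inr rfl⟩

namespace IsExploration

variable {𝒞 : Set (W ↪ V)} {φ : ℕ → W ↪ V} {b : ℕ → ℕ} {t : ℕ}

/-- If the pointer went back, the copy of step k + 1 would touch a step already finished at step k
and so would be covered before it is added. -/
lemma ptr_le_succ (h : IsExploration H 𝒞 φ b t) {k : ℕ} (h1 : 1 ≤ k) (hk : k + 1 < t) :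
    b k ≤ b (k + 1) := by
  by_contra! hcon
  exact h.not_subset (k + 1) (by omega) hk <|
    (h.finished k h1 (by omega) _ hcon _ (h.mem _ hk) (h.touch (k + 1) (by omega) hk)).trans
      (edgesBefore_mono φ (Nat.le_succ k))

lemma ptr_mono (h : IsExploration H 𝒞 φ b t) {k l : ℕ} (h1 : 1 ≤ k) (hkl : k ≤ l) (hl : l < t) :
    b k ≤ b l := by
  induction l, hkl using Nat.le_induction with
  | base => exact le_rfl
  | succ l hkl ih => exact (ih (by omega)).trans (h.ptr_le_succ (by omega) hl)

lemma touch_edgesBefore (h : IsExploration H 𝒞 φ b t) {k : ℕ} (h1 : 1 ≤ k) (hk : k < t) :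
    ¬ Disjoint (copyEdges H (φ k)) (edgesBefore H φ k) := fun hd =>
  h.touch k h1 hk (disjoint_of_subset_right (newEdges_subset φ (h.lt k h1 hk)) hd)

lemma take (h : IsExploration H 𝒞 φ b t) {t' : ℕ} (h1 : 1 ≤ t') (ht : t' ≤ t) :
    IsExploration H 𝒞 φ b t' :=
  ⟨h1, fun k hk => h.mem k (by omega), fun k hk hk' => h.lt k hk (by omega),
    fun k hk hk' => h.touch k hk (by omega), fun k hk hk' => h.not_subset k hk (by omega),
    fun k hk hk' => h.finished k hk (by omega)⟩

end IsExploration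

variable [Fintype W]

variable (H) in
/-- The vertices of the `j`-th copy of a sequence that are in no earlier one. -/
def innerVerts (φ : ℕ → W ↪ V) (j : ℕ) : Finset V :=
  copyVerts (φ j) \ edgeVerts (edgesBefore H φ j)

variable (H) in
/-- Step `i` is the first one after `j` to touch a vertex that is new in step `j`. -/
def Kills (φ : ℕ → W ↪ V) (j i : ℕ) : Prop :=
  j < i ∧ (∀ l, j < l → l < i → Disjoint (copyVerts (φ l)) (innerVerts H φ j)) ∧
    ¬ Disjoint (copyVerts (φ i)) (innerVerts H φ j)

lemma TwoDense.innerVerts_subset (hH : TwoDense H) (φ : ℕ → W ↪ V) {j k : ℕ} (h : j < k) :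
    innerVerts H φ j ⊆ edgeVerts (edgesBefore H φ k) := by
  intro w hw
  have hw := (mem_sdiff.1 hw).1
  rw [← hH.edgeVerts_copyEdges] at hw
  refine edgeVerts_mono (fun x hx => ?_) hw
  exact mem_edgesBefore.2 ⟨j, h, hx⟩

lemma TwoDense.disjoint_innerVerts (hH : TwoDense H) (φ : ℕ → W ↪ V) {i j : ℕ} (h : i ≠ j) :
    Disjoint (innerVerts H φ i) (innerVerts H φ j) := by
  wlog hij : i < j generalizing i j
  · exact (this h.symm (by omega)).symm
  · exact disjoint_of_subset_left (hH.innerVerts_subset φ hij) disjoint_sdiff_self_right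

/-- As long as the new vertices of step `j` are untouched, all edges at them are new in `j`. -/
lemma mem_newEdges_of_untouched {φ : ℕ → W ↪ V} {j k : ℕ}
    (hun : ∀ l, j < l → l < k → Disjoint (copyVerts (φ l)) (innerVerts H φ j))
    {x : Sym2 V} (hx : x ∈ edgesBefore H φ k) {w : V} (hwx : w ∈ x)
    (hw : w ∈ innerVerts H φ j) : x ∈ newEdges H φ j := by
  have hwE := (mem_sdiff.1 hw).2
  obtain ⟨i, hi, hxi⟩ := mem_edgesBefore.1 hx
  rcases lt_trichotomy i j with hij | rfl | hij
  · exact absurd (mem_edgeVerts.2 ⟨x, mem_edgesBefore.2 ⟨i, hij, hxi⟩, hwx⟩) hwE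
  · exact mem_sdiff.2 ⟨hxi, fun h => hwE (mem_edgeVerts.2 ⟨x, h, hwx⟩)⟩
  · exact absurd hw (disjoint_left.1 (hun i hij hi) (mem_copyVerts_of_mem hxi hwx))

/-- As long as the new vertices of a regular step `j` are untouched, its new edges lie in no other
copy. -/
lemma TwoDense.eq_of_untouched (hH : TwoDense H) {φ : ℕ → W ↪ V} {j k : ℕ} (hjk : j < k)
    (hreg : IsRegular (edgesBefore H φ j) (φ j))
    (htouch : ¬ Disjoint (copyEdges H (φ j)) (edgesBefore H φ j))
    (hun : ∀ l, j < l → l < k → Disjoint (copyVerts (φ l)) (innerVerts H φ j))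
    {ψ : W ↪ V} (hψ : copyEdges H ψ ⊆ edgesBefore H φ k) {x : Sym2 V} (hx : x ∈ copyEdges H ψ)
    (hxj : x ∈ newEdges H φ j) : copyEdges H ψ = copyEdges H (φ j) := by
  -- The other edges avoid the inner vertices of step j, so copy j may be regarded as glued on last,
  -- and `TwoDense.glue` applies.
  have hreg' : IsRegular (edgesBefore H φ k \ newEdges H φ j) (φ j) := by
    refine (card_le_card fun w hw => ?_).trans hreg
    obtain ⟨h1, h2⟩ := mem_inter.1 hw
    refine mem_inter.2 ⟨h1, ?_⟩
    by_contra hcon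
    obtain ⟨y, hy, hwy⟩ := mem_edgeVerts.1 h2
    obtain ⟨hyk, hyj⟩ := mem_sdiff.1 hy
    exact hyj (mem_newEdges_of_untouched hun hyk hwy (mem_sdiff.2 ⟨h1, hcon⟩))
  have htouch' : ¬ Disjoint (copyEdges H (φ j)) (edgesBefore H φ k \ newEdges H φ j) := by
    obtain ⟨y, hy, hyj⟩ := not_disjoint_iff.1 htouch
    exact not_disjoint_iff.2 ⟨y, hy, mem_sdiff.2 ⟨edgesBefore_mono φ hjk.le hyj,
      fun h => (mem_sdiff.1 h).2 hyj⟩⟩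
  refine (hH.glue hreg' htouch' ?_).resolve_left fun h => (mem_sdiff.1 (h hx)).2 hxj
  intro y hy
  by_cases hyj : y ∈ newEdges H φ j
  · exact mem_union_right _ (mem_sdiff.1 hyj).1
  · exact mem_union_left _ (mem_sdiff.2 ⟨hψ hy, hyj⟩)

lemma IsRegular.card_newEdges {φ : ℕ → W ↪ V} {j : ℕ}
    (hreg : IsRegular (edgesBefore H φ j) (φ j)) : #H.edgeFinset ≤ #(newEdges H φ j) + 1 := by
  have h1 := card_sdiff_add_card_inter (copyEdges H (φ j)) (edgesBefore H φ j)
  have h2 := hreg.card_inter_le (H := H)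
  rw [card_copyEdges] at h1
  rw [newEdges]
  omega

section Count

variable {𝒞 : Set (W ↪ V)} {φ : ℕ → W ↪ V} {b : ℕ → ℕ} {t : ℕ}

/-- In an exploration of a family of problematic copies, every regular step is killed. -/
lemma IsExploration.exists_kills (h : IsExploration H 𝒞 φ b t) (hH : TwoDense H)
    (hcov : ∀ ψ ∈ 𝒞, copyEdges H ψ ⊆ edgesBefore H φ t)
    (hprob : ∀ χ ∈ 𝒞, ∀ Y ⊆ copyEdges H χ, (∀ x ∈ Y, ∀ ψ ∈ 𝒞, x ∈ copyEdges H ψ →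
      copyEdges H ψ = copyEdges H χ) → #Y ≤ 1)
    {j : ℕ} (h1 : 1 ≤ j) (hj : j < t) (hreg : IsRegular (edgesBefore H φ j) (φ j)) :
    ∃ i < t, Kills H φ j i := by
  classical
  have hex : ∃ i, j < i ∧ i < t ∧ ¬ Disjoint (copyVerts (φ i)) (innerVerts H φ j) := by
    -- Otherwise the new edges of step j, at least e - 1 ≥ 2 of them, lie in no other copy, and copy
    -- j is unproblematic.
    by_contra! hcon
    have := hprob (φ j) (h.mem j hj) (newEdges H φ j) sdiff_subset fun x hx ψ hψ hxψ =>
      hH.eq_of_untouched hj hreg (h.touch_edgesBefore h1 hj) hcon (hcov ψ hψ) hxψ hx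
    have h2 := hreg.card_newEdges
    have h3 := hH.four_le
    have h4 := hH.card_le
    omega
  obtain ⟨hji, hit, hd⟩ := Nat.find_spec hex
  refine ⟨Nat.find hex, hit, hji, fun l hjl hl => ?_, hd⟩
  have := Nat.find_min hex hl
  by_contra hcon
  exact this ⟨hjl, hl.trans hit, hcon⟩

/-- A regular step kills at most the step that it is attached to. -/
lemma IsExploration.ptr_eq_of_kills (h : IsExploration H 𝒞 φ b t) (hH : TwoDense H)
    {i j : ℕ} (hi : i < t) (hreg : IsRegular (edgesBefore H φ i) (φ i)) (hk : Kills H φ j i) :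
    b i = j := by
  obtain ⟨hji, hun, hd⟩ := hk
  obtain ⟨w, hwi, hwj⟩ := not_disjoint_iff.1 hd
  obtain ⟨f, hfi, hfb⟩ := not_disjoint_iff.1 (h.touch i (by omega) hi)
  have hfE : f ∈ edgesBefore H φ i := newEdges_subset φ (h.lt i (by omega) hi) hfb
  have hfd := not_isDiag_of_mem_copyEdges hfi
  -- The two ends of f exhaust the old vertices of a regular copy, and the touched inner vertex w is
  -- old.
  have hwf : w ∈ f := by
    have hsub : f.toFinset ⊆ copyVerts (φ i) ∩ edgeVerts (edgesBefore H φ i) := by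
      intro u hu
      rw [Sym2.mem_toFinset] at hu
      exact mem_inter.2 ⟨mem_copyVerts_of_mem hfi hu, mem_edgeVerts.2 ⟨f, hfE, hu⟩⟩
    have heq := eq_of_subset_of_card_le hsub
      (by rw [Sym2.card_toFinset_of_not_isDiag f hfd]; exact hreg)
    rw [← Sym2.mem_toFinset, heq]
    exact mem_inter.2 ⟨hwi, hH.innerVerts_subset φ hji hwj⟩
  by_contra hne
  exact disjoint_left.1 (disjoint_newEdges φ hne) hfb
    (mem_newEdges_of_untouched hun hfE hwf hwj)

/-- A regular step that kills is followed by a step that is degenerate or does not kill. -/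
lemma IsExploration.succ_of_kills (h : IsExploration H 𝒞 φ b t) (hH : TwoDense H)
    (hcov : ∀ ψ ∈ 𝒞, copyEdges H ψ ⊆ edgesBefore H φ t)
    (hprob : ∀ χ ∈ 𝒞, ∀ Y ⊆ copyEdges H χ, (∀ x ∈ Y, ∀ ψ ∈ 𝒞, x ∈ copyEdges H ψ →
      copyEdges H ψ = copyEdges H χ) → #Y ≤ 1)
    {i j : ℕ} (h1 : 1 ≤ j) (hi : i < t) (hregj : IsRegular (edgesBefore H φ j) (φ j))
    (hregi : IsRegular (edgesBefore H φ i) (φ i)) (hk : Kills H φ j i) :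
    i + 1 < t ∧ ¬ (IsRegular (edgesBefore H φ (i + 1)) (φ (i + 1)) ∧
      ∃ j', Kills H φ j' (i + 1)) := by
  have hb := h.ptr_eq_of_kills hH hi hregi hk
  obtain ⟨hji, hun, hd⟩ := hk
  -- Step i uses only one new edge of step j, so at least e - 2 ≥ 2 of them remain open after step
  -- i. Hence some uncovered copy must still touch step j. Here e ≥ 4 is essential, and triangles
  -- fail.
  have key : ¬ ∀ ψ ∈ 𝒞, ¬ Disjoint (copyEdges H ψ) (newEdges H φ j) →
      copyEdges H ψ ⊆ edgesBefore H φ (i + 1) := by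
    intro hfin
    have hY := hprob (φ j) (h.mem j (hji.trans hi)) (newEdges H φ j \ copyEdges H (φ i))
      (sdiff_subset.trans sdiff_subset) (by
        intro x hx ψ hψ hxψ
        obtain ⟨hxj, hxi⟩ := mem_sdiff.1 hx
        have hsub := hfin ψ hψ (not_disjoint_iff.2 ⟨x, hxψ, hxj⟩)
        rw [edgesBefore_succ] at hsub
        rcases hH.glue hregi (h.touch_edgesBefore (by omega) hi) hsub with hs | hs
        · exact hH.eq_of_untouched hji hregj (h.touch_edgesBefore h1 (hji.trans hi)) hun hs hxψ hxj
        · exact absurd (hs ▸ hxψ) hxi)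
    have h2 := hregj.card_newEdges
    have h3 := hregi.card_inter_le (H := H)
    have h4 := hH.four_le
    have h5 := hH.card_le
    have h6 := card_sdiff_add_card_inter (newEdges H φ j) (copyEdges H (φ i))
    have h7 : #(newEdges H φ j ∩ copyEdges H (φ i)) ≤
        #(copyEdges H (φ i) ∩ edgesBefore H φ i) := by
      rw [inter_comm]
      exact card_le_card (inter_subset_inter_left (newEdges_subset φ hji))
    omega
  constructor
  · by_contra hcon
    have hit : i + 1 = t := by omega
    exact key fun ψ hψ _ => hit ▸ hcov ψ hψ
  · rintro ⟨hreg', j', hk'⟩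
    by_cases hit : i + 1 < t
    · have hb' := h.ptr_eq_of_kills hH hit hreg' hk'
      have hle := h.ptr_le_succ (k := i) (by omega) hit
      have hne : j ≠ j' := by
        rintro rfl
        exact hd (hk'.2.1 i hji (Nat.lt_succ_self i))
      exact key fun ψ hψ hψd => h.finished (i + 1) (by omega) hit j (by omega) ψ hψ hψd
    · exact key fun ψ hψ _ =>
        (hcov ψ hψ).trans (edgesBefore_mono φ (by omega))

/-- The killed steps have disjoint sets of inner vertices, and copy i contains a vertex of each. -/
lemma TwoDense.card_kills_le (hH : TwoDense H) (φ : ℕ → W ↪ V) (R : Finset ℕ) (i : ℕ)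
    (hR : ∀ j ∈ R, Kills H φ j i) : #R ≤ Fintype.card W := by
  rw [← card_copyVerts (φ i)]
  have : ∀ j, ∃ w, j ∈ R → w ∈ copyVerts (φ i) ∧ w ∈ innerVerts H φ j := by
    intro j
    by_cases hj : j ∈ R
    · obtain ⟨w, hw⟩ := not_disjoint_iff.1 (hR j hj).2.2
      exact ⟨w, fun _ => hw⟩
    · have : 0 < Fintype.card W := by have := hH.four_le; omega
      obtain ⟨u⟩ := Fintype.card_pos_iff.1 this
      exact ⟨φ 0 u, fun h => absurd h hj⟩
  choose g hg using this
  refine card_le_card_of_injOn g (fun j hj => (hg j hj).1) fun j hj j' hj' heq => ?_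
  by_contra hne
  exact disjoint_left.1 (hH.disjoint_innerVerts φ hne) (hg j hj).2 (heq ▸ (hg j' hj').2)

open scoped Classical in
variable (H) in
/-- The degenerate steps among the steps `1, …, t - 1`. -/
noncomputable def degenerateSteps (φ : ℕ → W ↪ V) (t : ℕ) : Finset ℕ :=
  (Ico 1 t).filter fun k => ¬ IsRegular (edgesBefore H φ k) (φ k)

/-- A complete exploration of a family of problematic copies has length linear in its number of
degenerate steps. -/
theorem IsExploration.length_le (h : IsExploration H 𝒞 φ b t) (hH : TwoDense H)
    (hcov : ∀ ψ ∈ 𝒞, copyEdges H ψ ⊆ edgesBefore H φ t)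
    (hprob : ∀ χ ∈ 𝒞, ∀ Y ⊆ copyEdges H χ, (∀ x ∈ Y, ∀ ψ ∈ 𝒞, x ∈ copyEdges H ψ →
      copyEdges H ψ = copyEdges H χ) → #Y ≤ 1) :
    t ≤ 1 + (2 * Fintype.card W + 2) * #(degenerateSteps H φ t) := by
  classical
  set R := (Ico 1 t).filter fun k => IsRegular (edgesBefore H φ k) (φ k) with hR
  have hsum : #R + #(degenerateSteps H φ t) = t - 1 := by
    rw [hR, degenerateSteps]
    convert card_filter_add_card_filter_not (s := Ico 1 t)
      (fun k => IsRegular (edgesBefore H φ k) (φ k)) using 1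
    rw [Nat.card_Ico]
  set Dg := degenerateSteps H φ t with hDg
  have hmemR : ∀ j, j ∈ R ↔ (1 ≤ j ∧ j < t) ∧ IsRegular (edgesBefore H φ j) (φ j) := by
    simp [hR]
  have hmemD : ∀ j, j ∈ Dg ↔ (1 ≤ j ∧ j < t) ∧ ¬ IsRegular (edgesBefore H φ j) (φ j) := by
    simp [hDg, degenerateSteps]
  have hex : ∀ j, ∃ i, j ∈ R → i < t ∧ Kills H φ j i := by
    intro j
    by_cases hj : j ∈ R
    · obtain ⟨⟨h1, h2⟩, h3⟩ := (hmemR j).1 hj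
      obtain ⟨i, hi⟩ := h.exists_kills hH hcov hprob h1 h2 h3
      exact ⟨i, fun _ => hi⟩
    · exact ⟨0, fun h => absurd h hj⟩
  choose κ hκ using hex
  have hsplit := card_filter_add_card_filter_not (s := R) (fun j => κ j ∈ Dg)
  have hA : #(R.filter fun j => κ j ∈ Dg) ≤ Fintype.card W * #Dg := by
    refine card_le_mul_card_image_of_maps_to (f := κ) (fun j hj => (mem_filter.1 hj).2) _ ?_
    intro i _
    refine hH.card_kills_le φ _ i fun j hj => ?_
    obtain ⟨hjR, rfl⟩ := mem_filter.1 hj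
    exact (hκ j (mem_filter.1 hjR).1).2
  -- The regular steps killed by regular steps; on them `κ` is injective because the pointer of the
  -- killer recovers the victim.
  set R' := R.filter fun j => ¬ κ j ∈ Dg with hR'
  have hκR : ∀ j ∈ R', κ j ∈ R := by
    intro j hj
    obtain ⟨hj, hjD⟩ := mem_filter.1 hj
    obtain ⟨hlt, hk⟩ := hκ j hj
    by_contra hcon
    have hle : 1 ≤ κ j := by have := hk.1; omega
    exact hjD ((hmemD _).2 ⟨⟨hle, hlt⟩, fun hreg => hcon ((hmemR _).2 ⟨⟨hle, hlt⟩, hreg⟩)⟩)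
  have hinj : Set.InjOn κ R' := by
    have : ∀ j ∈ R', b (κ j) = j := fun j hj =>
      h.ptr_eq_of_kills hH (hκ j (mem_filter.1 hj).1).1 ((hmemR _).1 (hκR j hj)).2
        (hκ j (mem_filter.1 hj).1).2
    intro j hj j' hj' heq
    rw [← this j hj, heq, this j' hj']
  have hX : #(R'.image κ) = #R' := card_image_of_injOn hinj
  have hXR : R'.image κ ⊆ R := by
    intro i hi
    obtain ⟨j, hj, rfl⟩ := mem_image.1 hi
    exact hκR j hj
  -- The successor of a regular killer is degenerate or a regular non-killer.
  have hB : #(R'.image κ) ≤ #(Dg ∪ (R \ R'.image κ)) := by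
    refine card_le_card_of_injOn (· + 1) ?_ (fun _ _ _ _ h => Nat.succ_injective h)
    intro i hi
    obtain ⟨j, hj, rfl⟩ := mem_image.1 hi
    have hjR := (mem_filter.1 hj).1
    obtain ⟨⟨h1, -⟩, h3⟩ := (hmemR j).1 hjR
    obtain ⟨hlt, hnot⟩ := h.succ_of_kills hH hcov hprob h1 (hκ j hjR).1 h3
      ((hmemR _).1 (hκR j hj)).2 (hκ j hjR).2
    have hpos : 1 ≤ κ j + 1 := Nat.le_add_left _ _
    by_cases hreg : IsRegular (edgesBefore H φ (κ j + 1)) (φ (κ j + 1))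
    · refine mem_union_right _ (mem_sdiff.2 ⟨(hmemR _).2 ⟨⟨hpos, hlt⟩, hreg⟩, fun hmem => ?_⟩)
      obtain ⟨j', hj', heq⟩ := mem_image.1 hmem
      have hk' := (hκ j' (mem_filter.1 hj').1).2
      rw [heq] at hk'
      exact hnot ⟨hreg, j', hk'⟩
    · exact mem_union_left _ ((hmemD _).2 ⟨⟨hpos, hlt⟩, hreg⟩)
  have hC := hB.trans (card_union_le _ _)
  have hD := card_sdiff_add_card_eq_card hXR
  have ht := h.one_le
  -- With a = #R - #R' ≤ v #Dg, the bound #R' ≤ #Dg + a gives #R ≤ (2v + 1) #Dg.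
  nlinarith [hsplit, hA, hC, hD, hX, hsum, Nat.sub_add_cancel ht]

end Count

end Exploration

/-! ### From the core to explorations -/

section Core

variable {W V : Type*} {H : SimpleGraph W} {G : SimpleGraph V} {K F : G.Subgraph}

lemma le_of_edgeSet_subset {J : G.Subgraph} (hJ : ∀ w ∈ J.verts, ∃ x ∈ J.edgeSet, w ∈ x)
    (h : J.edgeSet ⊆ F.edgeSet) : J ≤ F := by
  refine ⟨fun w hw => ?_, fun a b hab =>
    SimpleGraph.Subgraph.mem_edgeSet.1 (h (SimpleGraph.Subgraph.mem_edgeSet.2 hab))⟩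
  obtain ⟨x, hx, hwx⟩ := hJ w hw
  exact F.mem_verts_of_mem_edge (h hx) hwx

variable [Fintype H.edgeSet]

variable (H) in
/-- The copies of `H` in the subgraph `F`. -/
def copiesIn (F : G.Subgraph) : Set (W ↪ V) := {φ | (copyEdges H φ : Set (Sym2 V)) ⊆ F.edgeSet}

lemma IsHClosed.mem_copiesIn (hF : IsHClosed H K F) {J : G.Subgraph} (hJ : IsCopyIn H K J)
    {ψ : W ↪ V} (hψ : J.edgeSet = copyEdges H ψ) {x : Sym2 V} (hx : x ∈ J.edgeSet)
    (hxF : x ∈ F.edgeSet) : ψ ∈ copiesIn H F := by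
  rcases hF.2 J hJ with h | h
  · rw [copiesIn, Set.mem_ofPred_eq, ← hψ]
    exact SimpleGraph.Subgraph.edgeSet_mono h
  · exact absurd hxF (Set.disjoint_left.1 h hx)

variable [Fintype W]

lemma IsCopyIn.exists_embedding {J : G.Subgraph} (h : IsCopyIn H K J) :
    ∃ φ : W ↪ V, J.edgeSet = copyEdges H φ ∧ J.verts = copyVerts φ := by
  obtain ⟨-, ⟨f⟩⟩ := h
  refine ⟨f.toEquiv.toEmbedding.trans (Function.Embedding.subtype _), ?_, ?_⟩
  · rw [← SimpleGraph.Subgraph.image_coe_edgeSet_coe]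
    ext x
    simp only [Set.mem_image, mem_coe, mem_copyEdges, SimpleGraph.mem_edgeFinset]
    constructor
    · rintro ⟨y, hy, rfl⟩
      refine ⟨y.map f.symm, ?_, ?_⟩
      · induction y with
        | _ a b => simpa [SimpleGraph.Iso.map_adj_iff] using hy
      · induction y with
        | _ a b => simp
    · rintro ⟨y, hy, rfl⟩
      refine ⟨y.map f, ?_, ?_⟩
      · induction y with
        | _ a b => exact f.map_adj_iff.2 hy
      · induction y with
        | _ a b => simp
  · ext w
    simp only [mem_coe, mem_copyVerts]
    constructor
    · intro hw
      exact ⟨f.symm ⟨w, hw⟩, by simp⟩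
    · rintro ⟨u, rfl⟩
      exact (f u).2

lemma IsMinimalHClosed.nonempty_copiesIn (hK : IsHCore H K) (hF : IsMinimalHClosed H K F) :
    (copiesIn H F).Nonempty := by
  obtain ⟨e, he⟩ := hF.prop.2
  obtain ⟨J, hJ, heJ⟩ := hK.prop.1 e (SimpleGraph.Subgraph.edgeSet_mono hF.prop.1.1 he)
  obtain ⟨φ, hφ, -⟩ := hJ.exists_embedding
  exact ⟨φ, hF.prop.1.mem_copiesIn hJ hφ heJ he⟩

variable [DecidableEq V]

lemma TwoDense.verts_of_isCopyIn (hH : TwoDense H) {J : G.Subgraph} (h : IsCopyIn H K J) :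
    ∀ w ∈ J.verts, ∃ x ∈ J.edgeSet, w ∈ x := by
  obtain ⟨φ, he, hv⟩ := h.exists_embedding
  intro w hw
  rw [hv, mem_coe, ← hH.edgeVerts_copyEdges, mem_edgeVerts] at hw
  rw [he]
  exact hw

lemma TwoDense.exists_isCopyIn (hH : TwoDense H) {φ : W ↪ V}
    (h : (copyEdges H φ : Set (Sym2 V)) ⊆ K.edgeSet) :
    ∃ J, IsCopyIn H K J ∧ J.edgeSet = copyEdges H φ := by
  have hhom : ∀ {a b}, H.Adj a b → G.Adj (φ a) (φ b) := fun {a b} hab =>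
    K.adj_sub (h (mem_copyEdges.2 ⟨s(a, b), by simpa using hab, rfl⟩))
  let f : SimpleGraph.Copy H G := ⟨⟨φ, hhom⟩, φ.injective⟩
  have hE : f.toSubgraph.edgeSet = copyEdges H φ := by
    ext x
    simp only [SimpleGraph.Copy.toSubgraph, SimpleGraph.Subgraph.edgeSet_map, Set.mem_image,
      mem_coe, mem_copyEdges, SimpleGraph.mem_edgeFinset, SimpleGraph.Subgraph.edgeSet_top]
    rfl
  have hcopy : IsCopyIn H ⊤ f.toSubgraph := ⟨le_top, ⟨f.isoToSubgraph⟩⟩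
  exact ⟨f.toSubgraph, ⟨le_of_edgeSet_subset (hH.verts_of_isCopyIn hcopy) (hE ▸ h), hcopy.2⟩, hE⟩

/-- A nonempty union of copies that splits the copies in a minimal `H`-closed subgraph is the whole
of it. -/
lemma IsMinimalHClosed.subset_of_split (hH : TwoDense H) (hF : IsMinimalHClosed H K F)
    {X : Finset (Sym2 V)} (hne : X.Nonempty)
    (hX : ∀ x ∈ X, ∃ ψ ∈ copiesIn H F, x ∈ copyEdges H ψ)
    (hsplit : ∀ ψ ∈ copiesIn H F, copyEdges H ψ ⊆ X ∨ Disjoint (copyEdges H ψ) X) :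
    F.edgeSet ⊆ X ∧ F.verts ⊆ edgeVerts X := by
  have hXF : (X : Set (Sym2 V)) ⊆ F.edgeSet := fun x hx => by
    obtain ⟨ψ, hψ, hxψ⟩ := hX x hx
    exact hψ hxψ
  set F' := subgraphOf G (edgeVerts X : Set V) X (hXF.trans F.edgeSet_subset)
    (fun x hx w hw => mem_edgeVerts.2 ⟨x, hx, hw⟩) with hF'
  have hE : F'.edgeSet = X := edgeSet_subgraphOf ..
  have hle : F' ≤ F := by
    refine le_of_edgeSet_subset (fun w hw => ?_) (hE ▸ hXF)
    rw [hE]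
    exact mem_edgeVerts.1 hw
  have hclosed : IsHClosed H K F' := by
    refine ⟨hle.trans hF.prop.1.1, fun J hJ => ?_⟩
    obtain ⟨ψ, hψ, -⟩ := hJ.exists_embedding
    rcases hF.prop.1.2 J hJ with h | h
    · have hψF : ψ ∈ copiesIn H F := by
        rw [copiesIn, Set.mem_ofPred_eq, ← hψ]
        exact SimpleGraph.Subgraph.edgeSet_mono h
      rcases hsplit ψ hψF with h | h
      · refine Or.inl (le_of_edgeSet_subset (hH.verts_of_isCopyIn hJ) ?_)
        rw [hψ, hE]
        exact_mod_cast h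
      · right
        rw [hψ, hE]
        exact_mod_cast h
    · right
      exact h.mono_right (SimpleGraph.Subgraph.edgeSet_mono hle)
  have hFF' : F ≤ F' := hF.le_of_le ⟨hclosed, by rw [hE]; exact_mod_cast hne⟩ hle
  exact ⟨hE ▸ SimpleGraph.Subgraph.edgeSet_mono hFF', hFF'.1⟩

/-- Every copy in `K` through an edge of `F` lies in `F`, so an edge open within `F` is open in `K`.
Uniqueness is phrased through edge sets because automorphisms of `H` give one copy several
embeddings. -/
lemma IsHCore.card_open_le (hH : TwoDense H) (hK : IsHCore H K) (hF : IsHClosed H K F) :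
    ∀ χ ∈ copiesIn H F, ∀ Y ⊆ copyEdges H χ, (∀ x ∈ Y, ∀ ψ ∈ copiesIn H F, x ∈ copyEdges H ψ →
      copyEdges H ψ = copyEdges H χ) → #Y ≤ 1 := by
  intro χ hχ Y hY hopen
  by_contra! hcard
  obtain ⟨x, hx, y, hy, hxy⟩ := one_lt_card.1 hcard
  obtain ⟨J, hJ, hE⟩ := hH.exists_isCopyIn (K := K)
    (hχ.trans (SimpleGraph.Subgraph.edgeSet_mono hF.1))
  have hop : ∀ z ∈ Y, IsOpenEdge H K z := by
    intro z hz
    refine ⟨J, ⟨hJ, hE ▸ hY hz⟩, ?_⟩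
    rintro J' ⟨hJ', hzJ'⟩
    obtain ⟨ψ, hψ, -⟩ := hJ'.exists_embedding
    have hψF := hF.mem_copiesIn hJ' hψ hzJ' (hχ (hY hz))
    have heq := hopen z hz ψ hψF (by rw [hψ] at hzJ'; exact hzJ')
    have hEE : J'.edgeSet = J.edgeSet := by rw [hψ, hE, heq]
    exact le_antisymm (le_of_edgeSet_subset (hH.verts_of_isCopyIn hJ') hEE.le)
      (le_of_edgeSet_subset (hH.verts_of_isCopyIn hJ) hEE.ge)
  exact hK.prop.2 J hJ ⟨x, hE ▸ hY hx, y, hE ▸ hY hy, hxy, hop x hx, hop y hy⟩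

lemma card_edgeVerts_edgesBefore_le (φ : ℕ → W ↪ V) (k : ℕ) :
    #(edgeVerts (edgesBefore H φ k)) ≤ k * Fintype.card W := by
  have hsub : edgeVerts (edgesBefore H φ k) ⊆ (range k).biUnion fun i => copyVerts (φ i) := by
    intro w hw
    obtain ⟨x, hx, hwx⟩ := mem_edgeVerts.1 hw
    obtain ⟨i, hi, hxi⟩ := mem_edgesBefore.1 hx
    exact mem_biUnion.2 ⟨i, mem_range.2 hi, mem_copyVerts_of_mem hxi hwx⟩
  refine (card_le_card hsub).trans (card_biUnion_le.trans ?_)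
  simp

/-- A minimal `H`-closed subgraph of the core is small, or contains the copies of an exploration
that is long or has many degenerate steps. -/
theorem IsMinimalHClosed.exists_exploration (hH : TwoDense H) (hK : IsHCore H K)
    (hF : IsMinimalHClosed H K F) (D T : ℕ) (hT : 1 ≤ T) :
    F.verts.ncard ≤ (1 + (2 * Fintype.card W + 2) * D) * Fintype.card W ∨
    ∃ φ b t, t ≤ T ∧ IsExploration H (copiesIn H F) φ b t ∧
      (t = T ∨ D ≤ #(degenerateSteps H φ t)) := by
  have hHne : H.edgeFinset.Nonempty := by
    rw [← card_pos]
    have := hH.four_le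
    have := hH.card_le
    omega
  obtain ⟨φ, b, t, htT, hexp, hcov | rfl⟩ := HCore.exists_exploration
    (hF.nonempty_copiesIn hK) hHne (fun X hne hX hsplit ψ hψ x hx => by
      have := (hF.subset_of_split hH hne hX hsplit).1 (hψ hx)
      exact_mod_cast this) T hT
  · by_cases hD : D ≤ #(degenerateSteps H φ t)
    · exact Or.inr ⟨φ, b, t, htT, hexp, Or.inr hD⟩
    left
    have hlen := hexp.length_le hH hcov (hK.card_open_le hH hF.prop.1)
    have hne : (edgesBefore H φ t).Nonempty := by
      obtain ⟨y, hy⟩ := hHne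
      exact ⟨_, mem_edgesBefore.2 ⟨0, hexp.one_le, mem_copyEdges.2 ⟨y, hy, rfl⟩⟩⟩
    have hverts := (hF.subset_of_split hH hne (fun x hx => by
      obtain ⟨i, hi, hxi⟩ := mem_edgesBefore.1 hx
      exact ⟨φ i, hexp.mem i hi, hxi⟩) (fun ψ hψ => Or.inl (hcov ψ hψ))).2
    calc F.verts.ncard ≤ (edgeVerts (edgesBefore H φ t) : Set V).ncard :=
          Set.ncard_le_ncard hverts (Finset.finite_toSet _)
      _ = #(edgeVerts (edgesBefore H φ t)) := Set.ncard_coe_finset _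
      _ ≤ t * Fintype.card W := card_edgeVerts_edgesBefore_le φ t
      _ ≤ _ := by
        refine Nat.mul_le_mul_right _ (hlen.trans ?_)
        gcongr
        omega
  · exact Or.inr ⟨φ, b, t, le_rfl, hexp, Or.inl rfl⟩

end Core

/-! ### Edge probabilities and expected numbers of attachments -/

lemma binomialRandom_real_subset_le {V : Type*} [Finite V] (p : unitInterval)
    (X : Finset (Sym2 V)) (hX : ∀ x ∈ X, ¬ x.IsDiag) :
    (SimpleGraph.binomialRandom V p).real {G | (X : Set (Sym2 V)) ⊆ G.edgeSet} ≤
      (p : ℝ) ^ #X := by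
  have h : SimpleGraph.binomialRandom V p {G | (X : Set (Sym2 V)) ⊆ G.edgeSet} ≤
      (unitInterval.toNNReal p : ENNReal) ^ #X := by
    rw [SimpleGraph.binomialRandom_apply]
    calc _ ≤ Measure.infinitePi (fun e : Sym2 V =>
          unitInterval.toNNReal p • Measure.dirac (¬ e.IsDiag) +
            unitInterval.toNNReal (unitInterval.symm p) • Measure.dirac False)
          (Set.pi X fun _ => {True}) := by
            refine measure_mono ?_
            rintro _ ⟨G, hG, rfl⟩ e he
            simpa using hG he
      _ = ∏ _e ∈ X, (unitInterval.toNNReal p : ENNReal) := by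
            rw [Measure.infinitePi_pi _ (fun _ _ => .of_discrete)]
            refine prod_congr rfl fun e he => ?_
            simp [hX e he]
      _ = _ := by simp
  rw [measureReal_def]
  refine (ENNReal.toReal_mono (by simp) h).trans ?_
  simp

section Counting

variable {W V : Type*} [Fintype W] [Fintype V] [DecidableEq V]

open scoped Classical in
lemma card_embedding_le (S : Finset W) (U : W → Finset V) :
    #{ψ : W ↪ V | ∀ w ∈ S, ψ w ∈ U w} ≤
      (∏ w ∈ S, #(U w)) * Fintype.card V ^ (Fintype.card W - #S) := by
  calc #{ψ : W ↪ V | ∀ w ∈ S, ψ w ∈ U w}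
      ≤ #(Fintype.piFinset fun w => if w ∈ S then U w else univ) := by
        refine card_le_card_of_injOn (fun ψ => ψ) (fun ψ hψ => ?_)
          (DFunLike.coe_injective.injOn)
        simp only [coe_filter, mem_univ, true_and, Set.mem_ofPred_eq] at hψ
        simp only [mem_coe, Fintype.mem_piFinset]
        intro w
        split_ifs with hw
        · exact hψ w hw
        · exact mem_univ _
    _ = _ := by
        rw [Fintype.card_piFinset]
        simp_rw [apply_ite card]
        rw [prod_ite]
        simp [filter_not, card_sdiff_of_subset]

variable {H : SimpleGraph W} [Fintype H.edgeSet]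

-- A shared edge prescribes the images of two vertices of `H`: at most v^4 choices of two vertices
-- and their values, and v - 2 vertices remain free.
open scoped Classical in
lemma card_touching_le (χ : W ↪ V) :
    #{ψ : W ↪ V | ¬ Disjoint (copyEdges H ψ) (copyEdges H χ)} ≤
      Fintype.card W ^ 4 * Fintype.card V ^ (Fintype.card W - 2) := by
  calc #{ψ : W ↪ V | ¬ Disjoint (copyEdges H ψ) (copyEdges H χ)}
      ≤ #((univ : Finset ((W × W) × (W × W))).biUnion fun u => {ψ : W ↪ V |
          u.1.1 ≠ u.1.2 ∧ ψ u.1.1 = χ u.2.1 ∧ ψ u.1.2 = χ u.2.2}) := by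
        refine card_le_card fun ψ hψ => ?_
        simp only [mem_filter, mem_univ, true_and, not_disjoint_iff] at hψ
        obtain ⟨x, hx, hxχ⟩ := hψ
        have hd := not_isDiag_of_mem_copyEdges hx
        obtain ⟨y, -, rfl⟩ := mem_copyEdges.1 hx
        obtain ⟨z, -, hz⟩ := mem_copyEdges.1 hxχ
        induction y with
        | _ a b =>
          induction z with
          | _ c d =>
            simp only [Sym2.map_mk, Sym2.eq_iff] at hz
            simp only [Sym2.map_mk, Sym2.mk_isDiag_iff] at hd
            have hab : a ≠ b := fun h => hd (by rw [h])
            simp only [mem_biUnion, mem_univ, true_and, mem_filter, Prod.exists]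
            rcases hz with ⟨h1, h2⟩ | ⟨h1, h2⟩
            · exact ⟨a, b, c, d, hab, h1.symm, h2.symm⟩
            · exact ⟨a, b, d, c, hab, h2.symm, h1.symm⟩
    _ ≤ ∑ _u : (W × W) × (W × W), Fintype.card V ^ (Fintype.card W - 2) := by
        refine card_biUnion_le.trans (sum_le_sum ?_)
        rintro ⟨⟨a, b⟩, ⟨c, d⟩⟩ -
        by_cases hab : a = b
        · simp [hab]
        · have := card_embedding_le ({a, b} : Finset W)
            (fun w => ({if w = a then χ c else χ d} : Finset V))
          rw [card_pair hab] at this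
          refine (card_le_card ?_).trans (this.trans (by simp))
          intro ψ hψ
          simp only [mem_filter, mem_univ, true_and] at hψ
          simp [hψ.2.1, hψ.2.2, Ne.symm hab]
    _ = _ := by
        simp only [sum_const, card_univ, Fintype.card_prod, smul_eq_mul]
        ring

variable {p η : ℝ} {A : Finset (Sym2 V)}

/-- The expected number of ways to attach a copy regularly to a given copy. -/
lemma sum_regular_le (hp0 : 0 ≤ p) (hp1 : p ≤ 1) (χ : W ↪ V) (S : Finset (W ↪ V))
    (hS : ∀ ψ ∈ S, ¬ Disjoint (copyEdges H ψ) (copyEdges H χ) ∧ IsRegular A ψ) :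
    ∑ ψ ∈ S, p ^ #(copyEdges H ψ \ A) ≤ (Fintype.card W : ℝ) ^ 4 *
      ((Fintype.card V : ℝ) ^ (Fintype.card W - 2) * p ^ (#H.edgeFinset - 1)) := by
  have hcard : #S ≤ Fintype.card W ^ 4 * Fintype.card V ^ (Fintype.card W - 2) :=
    (card_le_card fun ψ hψ => by simpa using (hS ψ hψ).1).trans (card_touching_le (H := H) χ)
  calc ∑ ψ ∈ S, p ^ #(copyEdges H ψ \ A) ≤ ∑ ψ ∈ S, p ^ (#H.edgeFinset - 1) := by
        refine sum_le_sum fun ψ hψ => pow_le_pow_of_le_one hp0 hp1 ?_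
        have h1 := (hS ψ hψ).2.card_inter_le (H := H)
        have h2 := card_sdiff_add_card_inter (copyEdges H ψ) A
        rw [card_copyEdges] at h2
        omega
    _ = #S * p ^ (#H.edgeFinset - 1) := by simp
    _ ≤ (Fintype.card W ^ 4 * Fintype.card V ^ (Fintype.card W - 2) : ℕ) *
          p ^ (#H.edgeFinset - 1) := by
        gcongr
    _ = _ := by push_cast; ring

/-- The expected number of ways to attach a copy in a degenerate way. -/
lemma TwoDense.sum_degenerate_le (hH : TwoDense H) (hη0 : 0 ≤ η)
    (hV : 0 < Fintype.card V) {M : ℕ} (hM : 1 ≤ M) (hA : #(edgeVerts A) ≤ M)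
    (hη : ∀ s x : ℕ, s ≤ Fintype.card W → x ≤ #H.edgeFinset →
      ((#H.edgeFinset : ℤ) - 1) * (Fintype.card W - s) + 1 ≤
        ((#H.edgeFinset : ℤ) - x) * (Fintype.card W - 2) →
      p ^ (#H.edgeFinset - x) * (Fintype.card V : ℝ) ^ (Fintype.card W - s) ≤ η)
    (S : Finset (W ↪ V)) (hS : ∀ ψ ∈ S, ¬ copyEdges H ψ ⊆ A ∧ ¬ IsRegular A ψ) :
    ∑ ψ ∈ S, p ^ #(copyEdges H ψ \ A) ≤ 2 ^ Fintype.card W * (M : ℝ) ^ Fintype.card W * η := by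
  classical
  have hV' : (0 : ℝ) < Fintype.card V := by exact_mod_cast hV
  let g : (W ↪ V) → Finset W := fun ψ => {w | ψ w ∈ edgeVerts A}
  have hg : ∀ ψ, copyVerts ψ ∩ edgeVerts A = (g ψ).map ψ := by
    intro ψ
    ext w
    simp only [mem_inter, mem_copyVerts, mem_map, g, mem_filter, mem_univ, true_and]
    grind
  have hterm : ∀ ψ ∈ S, p ^ #(copyEdges H ψ \ A) ≤
      η / (Fintype.card V : ℝ) ^ (Fintype.card W - #(g ψ)) := by
    intro ψ hψ
    obtain ⟨h1, h2⟩ := hS ψ hψ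
    rw [le_div_iff₀ (by positivity)]
    have h3 := card_sdiff_add_card_inter (copyEdges H ψ) A
    rw [card_copyEdges] at h3
    have h4 : #(copyEdges H ψ \ A) = #H.edgeFinset - #(copyEdges H ψ ∩ A) := by omega
    rw [h4]
    refine hη _ _ (card_le_univ _) (by omega) ?_
    rw [IsRegular] at h2
    have h5 := hH.dens_copy ψ (U := copyVerts ψ ∩ edgeVerts A) (X := copyEdges H ψ ∩ A)
      inter_subset_left inter_subset_left (fun x hx w hw => mem_inter.2
        ⟨mem_copyVerts_of_mem (mem_inter.1 hx).1 hw,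
          mem_edgeVerts.2 ⟨x, (mem_inter.1 hx).2, hw⟩⟩) (by omega)
      (fun h => h1 (inter_eq_left.1 h))
    rwa [hg, card_map] at h5
  calc ∑ ψ ∈ S, p ^ #(copyEdges H ψ \ A)
      ≤ ∑ ψ ∈ S, η / (Fintype.card V : ℝ) ^ (Fintype.card W - #(g ψ)) := sum_le_sum hterm
    -- The copies are grouped by the set U of vertices sent to old ones. The n^(v-#U) choices for
    -- the rest cancel the denominator, leaving a factor of at most M^v for the old images and 2^v
    -- for U.
    _ = ∑ U : Finset W, ∑ ψ ∈ S with g ψ = U,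
          η / (Fintype.card V : ℝ) ^ (Fintype.card W - #(g ψ)) :=
        (sum_fiberwise S g _).symm
    _ ≤ ∑ _U : Finset W, (M : ℝ) ^ Fintype.card W * η := by
        refine sum_le_sum fun U _ => ?_
        have hcard : #{ψ ∈ S | g ψ = U} ≤
            M ^ Fintype.card W * Fintype.card V ^ (Fintype.card W - #U) := by
          calc #{ψ ∈ S | g ψ = U} ≤ #{ψ : W ↪ V | ∀ w ∈ U, ψ w ∈ edgeVerts A} := by
                refine card_le_card fun ψ hψ => ?_
                obtain ⟨-, rfl⟩ := mem_filter.1 hψ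
                simp [g]
            _ ≤ (∏ _w ∈ U, #(edgeVerts A)) * Fintype.card V ^ (Fintype.card W - #U) :=
                card_embedding_le U fun _ => edgeVerts A
            _ ≤ _ := by
                rw [prod_const]
                exact Nat.mul_le_mul_right _ ((Nat.pow_le_pow_left hA _).trans
                  (Nat.pow_le_pow_right hM (card_le_univ _)))
        calc ∑ ψ ∈ S with g ψ = U, η / (Fintype.card V : ℝ) ^ (Fintype.card W - #(g ψ))
            = ∑ ψ ∈ S with g ψ = U, η / (Fintype.card V : ℝ) ^ (Fintype.card W - #U) :=
              sum_congr rfl fun ψ hψ => by rw [(mem_filter.1 hψ).2]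
          _ = #{ψ ∈ S | g ψ = U} * (η / (Fintype.card V : ℝ) ^ (Fintype.card W - #U)) := by
              simp
          _ ≤ (M ^ Fintype.card W * Fintype.card V ^ (Fintype.card W - #U) : ℕ) *
                (η / (Fintype.card V : ℝ) ^ (Fintype.card W - #U)) := by
              gcongr
          _ = _ := by
              push_cast
              field_simp
    _ = _ := by
        simp [Fintype.card_finset, mul_assoc]

end Counting

/-! ### Continuations of a beginning, and their probability -/

section Exploration

variable {W V : Type*} [Fintype W] [DecidableEq V] (H : SimpleGraph W) [Fintype H.edgeSet]

/-- The graph `G` contains the copies `s 0, …, s (k - 1)` and a continuation by `t` further copies,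
`r` of them degenerate, each touching an earlier one whose index is at least `a` and does not
decrease. -/
def HasContinuation (G : SimpleGraph V) : ℕ → (ℕ → W ↪ V) → ℕ → ℕ → ℕ → Prop
  | 0, s, k, _, r => (edgesBefore H s k : Set (Sym2 V)) ⊆ G.edgeSet ∧ r = 0
  | t + 1, s, k, a, r => ∃ b, a ≤ b ∧ b < k ∧ ∃ ψ : W ↪ V,
      ¬ Disjoint (copyEdges H ψ) (copyEdges H (s b)) ∧ ¬ copyEdges H ψ ⊆ edgesBefore H s k ∧
      ((IsRegular (edgesBefore H s k) ψ ∧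
          HasContinuation G t (Function.update s k ψ) (k + 1) b r) ∨
        (¬ IsRegular (edgesBefore H s k) ψ ∧ ∃ r', r = r' + 1 ∧
          HasContinuation G t (Function.update s k ψ) (k + 1) b r'))

variable {H}

/-- For the union bound the family of copies and the field `finished` are forgotten; only the
monotonicity of the pointer survives. -/
lemma IsExploration.hasContinuation {𝒞 : Set (W ↪ V)} {φ : ℕ → W ↪ V} {b : ℕ → ℕ} {t : ℕ}
    (h : IsExploration H 𝒞 φ b t) {G : SimpleGraph V}
    (hG : (edgesBefore H φ t : Set (Sym2 V)) ⊆ G.edgeSet) (m : ℕ) :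
    ∀ (k a : ℕ) (s : ℕ → W ↪ V), 1 ≤ k → k + m = t → (∀ i < k, s i = φ i) →
      (∀ l, k ≤ l → l < t → a ≤ b l) →
      HasContinuation H G m s k a #{l ∈ degenerateSteps H φ t | k ≤ l} := by
  classical
  induction m with
  | zero =>
    intro k a s h1 hk hs _
    refine ⟨?_, ?_⟩
    · rw [edgesBefore_congr hs]
      rw [add_zero] at hk
      rwa [hk]
    · rw [card_eq_zero, filter_eq_empty_iff]
      intro l hl
      have := (mem_Ico.1 (mem_filter.1 hl).1).2
      omega
  | succ m ih =>
    intro k a s h1 hk hs ha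
    have hkt : k < t := by omega
    have hE : edgesBefore H s k = edgesBefore H φ k := edgesBefore_congr hs
    have hb := h.lt k h1 hkt
    have hs' : ∀ i < k + 1, Function.update s k (φ k) i = φ i := by
      intro i hi
      rcases Nat.lt_succ_iff_lt_or_eq.1 hi with hi | rfl
      · rw [Function.update_of_ne hi.ne, hs i hi]
      · rw [Function.update_self]
    have hcont := ih (k + 1) (b k) (Function.update s k (φ k)) (by omega) (by omega) hs'
      fun l hl hlt => h.ptr_mono h1 (by omega) hlt
    refine ⟨b k, ha k le_rfl hkt, hb, φ k, ?_, hE ▸ h.not_subset k h1 hkt, ?_⟩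
    · rw [hs _ hb]
      exact fun hd => h.touch k h1 hkt (disjoint_of_subset_right sdiff_subset hd)
    · rw [hE]
      by_cases hreg : IsRegular (edgesBefore H φ k) (φ k)
      · refine Or.inl ⟨hreg, ?_⟩
        convert hcont using 2
        refine filter_congr fun l hl => ⟨fun hkl => ?_, fun hkl => by omega⟩
        rcases hkl.eq_or_lt with rfl | hkl
        · exact absurd hreg (mem_filter.1 hl).2
        · exact hkl
      · refine Or.inr ⟨hreg, _, ?_, hcont⟩
        have hmem : k ∈ {l ∈ degenerateSteps H φ t | k ≤ l} := by
          simp [degenerateSteps, h1, hkt, hreg]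
        rw [← card_erase_add_one hmem]
        congr 2
        ext l
        simp only [mem_erase, mem_filter]
        grind

lemma exists_card_degenerateSteps_eq (φ : ℕ → W ↪ V) {t D : ℕ} (ht : 1 ≤ t)
    (hD : D ≤ #(degenerateSteps H φ t)) :
    ∃ t', 1 ≤ t' ∧ t' ≤ t ∧ #(degenerateSteps H φ t') = D := by
  classical
  induction t, ht using Nat.le_induction with
  | base => exact ⟨1, le_rfl, le_rfl, by simp_all [degenerateSteps]⟩
  | succ t ht ih =>
    by_cases hle : D ≤ #(degenerateSteps H φ t)
    · obtain ⟨t', h1, h2, h3⟩ := ih hle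
      exact ⟨t', h1, by omega, h3⟩
    · refine ⟨t + 1, by omega, le_rfl, ?_⟩
      have : degenerateSteps H φ (t + 1) ⊆ insert t (degenerateSteps H φ t) := by
        intro k hk
        simp only [degenerateSteps, mem_filter, mem_Ico, mem_insert] at hk ⊢
        by_cases hkt : k = t
        · exact Or.inl hkt
        · exact Or.inr ⟨by omega, hk.2⟩
      have := (card_le_card this).trans (card_insert_le _ _)
      omega

end Exploration

section Probability

variable {W V : Type*} [Fintype W] [Fintype V] [DecidableEq V] {H : SimpleGraph W}
  [Fintype H.edgeSet]

lemma sum_Ico_half_pow_le (a k : ℕ) : ∑ b ∈ Ico a k, (1 / 2 : ℝ) ^ b ≤ 2 * (1 / 2) ^ a := by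
  rw [sum_Ico_eq_sum_range]
  simp_rw [pow_add]
  rw [← mul_sum, mul_comm]
  gcongr
  exact sum_geometric_two_le _

open scoped Classical in
/-- The probability that a given beginning occurs and has a continuation with `r` degenerate
steps. -/
lemma hasContinuation_le (p : unitInterval) {q : ℝ} (hq : 0 ≤ q) (N : ℕ)
    (hreg : ∀ (A : Finset (Sym2 V)) (χ : W ↪ V) (S : Finset (W ↪ V)),
      (∀ ψ ∈ S, ¬ Disjoint (copyEdges H ψ) (copyEdges H χ) ∧ IsRegular A ψ) →
      ∑ ψ ∈ S, (p : ℝ) ^ #(copyEdges H ψ \ A) ≤ 1 / 16)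
    (hdeg : ∀ (A : Finset (Sym2 V)) (S : Finset (W ↪ V)), #(edgeVerts A) ≤ N * Fintype.card W →
      (∀ ψ ∈ S, ¬ copyEdges H ψ ⊆ A ∧ ¬ IsRegular A ψ) →
      ∑ ψ ∈ S, (p : ℝ) ^ #(copyEdges H ψ \ A) ≤ q / 16) (t : ℕ) :
    ∀ (s : ℕ → W ↪ V) (k a r : ℕ), a ≤ k → k + t ≤ N →
      (SimpleGraph.binomialRandom V p).real {G | HasContinuation H G t s k a r} ≤
        (p : ℝ) ^ #(edgesBefore H s k) * (2 ^ N * (1 / 2) ^ a * (1 / 4) ^ t * q ^ r) := by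
  have hp0 : (0 : ℝ) ≤ p := p.2.1
  induction t with
  | zero =>
    intro s k a r ha hk
    by_cases hr : r = 0
    · subst hr
      have h1 : (SimpleGraph.binomialRandom V p).real {G | HasContinuation H G 0 s k a 0} ≤
          (p : ℝ) ^ #(edgesBefore H s k) := by
        refine le_trans (measureReal_mono ?_) (binomialRandom_real_subset_le p _ ?_)
        · exact fun G hG => hG.1
        · intro x hx
          obtain ⟨i, -, hxi⟩ := mem_edgesBefore.1 hx
          exact not_isDiag_of_mem_copyEdges hxi
      refine h1.trans (le_mul_of_one_le_right (by positivity) ?_)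
      -- The factor 2^N keeps the bound nontrivially large at the end, as a ≤ k ≤ N.
      have h2 : (1 : ℝ) ≤ 2 ^ (N - a) := one_le_pow₀ (by norm_num)
      have h3 : (2 : ℝ) ^ N = 2 ^ (N - a) * 2 ^ a := by
        rw [← pow_add]; congr 1; omega
      rw [h3, mul_assoc (2 ^ (N - a)), ← mul_pow]
      simpa using h2
    · have : {G : SimpleGraph V | HasContinuation H G 0 s k a r} = ∅ := by
        ext G
        simp [HasContinuation, hr]
      rw [this, measureReal_empty]
      positivity
  | succ t ih =>
    intro s k a r ha hk
    set E := edgesBefore H s k with hE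
    let R : ℕ → Finset (W ↪ V) := fun b =>
      {ψ | ¬ Disjoint (copyEdges H ψ) (copyEdges H (s b)) ∧ IsRegular E ψ}
    let Dg : Finset (W ↪ V) := {ψ | ¬ copyEdges H ψ ⊆ E ∧ ¬ IsRegular E ψ}
    -- The weight (1/2)^b pays for the choice of the pointer: its sum over b ≥ a is at most 2
    -- (1/2)^a. Regular and degenerate attachments contribute 1/16 + 1/16 per pointer, so each step
    -- costs a factor 1/4.
    let f : ℕ → ℝ := fun b => 2 ^ N * (1 / 2) ^ b * (1 / 4) ^ t
    have hf : ∀ b, 0 ≤ f b := fun b => by positivity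
    have hEcard : #(edgeVerts E) ≤ N * Fintype.card W :=
      (card_edgeVerts_edgesBefore_le s k).trans (Nat.mul_le_mul_right _ (by omega))
    have hstep : ∀ (S : Finset (W ↪ V)) (b r' : ℕ), b < k →
        (SimpleGraph.binomialRandom V p).real
          (⋃ ψ ∈ S, {G | HasContinuation H G t (Function.update s k ψ) (k + 1) b r'}) ≤
        (p : ℝ) ^ #E * (f b * q ^ r') * ∑ ψ ∈ S, (p : ℝ) ^ #(copyEdges H ψ \ E) := by
      intro S b r' hb
      refine (measureReal_biUnion_finset_le _ _).trans ?_
      rw [mul_sum]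
      refine sum_le_sum fun ψ _ => (ih _ _ _ _ (by omega) (by omega)).trans_eq ?_
      rw [edgesBefore_update_succ, ← hE, ← union_sdiff_self_eq_union,
        card_union_of_disjoint disjoint_sdiff, pow_add]
      simp only [f]
      ring
    have hcover : ∀ (B : ℕ → Set (SimpleGraph V)) (c : ℝ),
        (∀ b ∈ Ico a k, (SimpleGraph.binomialRandom V p).real (B b) ≤
          (p : ℝ) ^ #E * f b * c) → 0 ≤ c →
        (SimpleGraph.binomialRandom V p).real (⋃ b ∈ Ico a k, B b) ≤
          (p : ℝ) ^ #E * (2 ^ N * (1 / 2) ^ a * (1 / 4) ^ t) * 2 * c := by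
      intro B c hB hc
      refine (measureReal_biUnion_finset_le _ _).trans ((sum_le_sum hB).trans ?_)
      calc ∑ b ∈ Ico a k, (p : ℝ) ^ #E * f b * c
          = (p : ℝ) ^ #E * 2 ^ N * (1 / 4) ^ t * c * ∑ b ∈ Ico a k, (1 / 2 : ℝ) ^ b := by
            rw [mul_sum]
            refine sum_congr rfl fun b _ => ?_
            simp only [f]
            ring
        _ ≤ (p : ℝ) ^ #E * 2 ^ N * (1 / 4) ^ t * c * (2 * (1 / 2) ^ a) := by
            gcongr
            exact sum_Ico_half_pow_le a k
        _ = _ := by ring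
    have hRsum : ∀ b, ∑ ψ ∈ R b, (p : ℝ) ^ #(copyEdges H ψ \ E) ≤ 1 / 16 := fun b =>
      hreg E (s b) (R b) fun ψ hψ => (mem_filter.1 hψ).2
    have hDsum : ∑ ψ ∈ Dg, (p : ℝ) ^ #(copyEdges H ψ \ E) ≤ q / 16 :=
      hdeg E Dg hEcard fun ψ hψ => (mem_filter.1 hψ).2
    have hR : ∀ b < k, (SimpleGraph.binomialRandom V p).real
        (⋃ ψ ∈ R b, {G | HasContinuation H G t (Function.update s k ψ) (k + 1) b r}) ≤
        (p : ℝ) ^ #E * f b * (q ^ r / 16) := by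
      intro b hb
      refine (hstep (R b) b r hb).trans ?_
      calc (p : ℝ) ^ #E * (f b * q ^ r) * ∑ ψ ∈ R b, (p : ℝ) ^ #(copyEdges H ψ \ E)
          ≤ (p : ℝ) ^ #E * (f b * q ^ r) * (1 / 16) := by
            have := hf b
            gcongr
            exact hRsum b
        _ = _ := by ring
    have hD : ∀ r', r = r' + 1 → ∀ b < k, (SimpleGraph.binomialRandom V p).real
        (⋃ ψ ∈ Dg, {G | HasContinuation H G t (Function.update s k ψ) (k + 1) b r'}) ≤
        (p : ℝ) ^ #E * f b * (q ^ r / 16) := by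
      rintro r' rfl b hb
      refine (hstep Dg b r' hb).trans ?_
      calc (p : ℝ) ^ #E * (f b * q ^ r') * ∑ ψ ∈ Dg, (p : ℝ) ^ #(copyEdges H ψ \ E)
          ≤ (p : ℝ) ^ #E * (f b * q ^ r') * (q / 16) := by
            have := hf b
            gcongr
        _ = _ := by ring
    let B : ℕ → Set (SimpleGraph V) := fun b =>
      (⋃ ψ ∈ R b, {G | HasContinuation H G t (Function.update s k ψ) (k + 1) b r}) ∪
      ⋃ ψ ∈ Dg, {G | ∃ r', r = r' + 1 ∧
        HasContinuation H G t (Function.update s k ψ) (k + 1) b r'}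
    have hB : ∀ b ∈ Ico a k, (SimpleGraph.binomialRandom V p).real (B b) ≤
        (p : ℝ) ^ #E * f b * (q ^ r / 8) := by
      intro b hb
      have hbk := (mem_Ico.1 hb).2
      have hsecond : (SimpleGraph.binomialRandom V p).real (⋃ ψ ∈ Dg, {G | ∃ r', r = r' + 1 ∧
          HasContinuation H G t (Function.update s k ψ) (k + 1) b r'}) ≤
          (p : ℝ) ^ #E * f b * (q ^ r / 16) := by
        rcases r with _ | r'
        · have := hf b
          simp only [Nat.right_eq_add, Nat.add_eq_zero_iff, one_ne_zero, and_false, false_and,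
            exists_false, Set.ofPred_false, Set.iUnion_empty, measureReal_empty]
          positivity
        · simpa using hD r' rfl b hbk
      calc _ ≤ _ := measureReal_union_le _ _
        _ ≤ (p : ℝ) ^ #E * f b * (q ^ r / 16) + (p : ℝ) ^ #E * f b * (q ^ r / 16) :=
            add_le_add (hR b hbk) hsecond
        _ = _ := by ring
    have hsub : {G | HasContinuation H G (t + 1) s k a r} ⊆ ⋃ b ∈ Ico a k, B b := by
      rintro G ⟨b, hab, hbk, ψ, h1, h2, h3⟩
      refine Set.mem_biUnion (mem_coe.2 (mem_Ico.2 ⟨hab, hbk⟩)) ?_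
      rcases h3 with ⟨h3, h4⟩ | ⟨h3, h4⟩
      · exact Or.inl (Set.mem_biUnion (x := ψ)
          (mem_coe.2 (mem_filter.2 ⟨mem_univ _, h1, h3⟩)) h4)
      · exact Or.inr (Set.mem_biUnion (x := ψ)
          (mem_coe.2 (mem_filter.2 ⟨mem_univ _, h2, h3⟩)) h4)
    refine (measureReal_mono hsub (measure_ne_top _ _)).trans ((hcover B _ hB (by positivity)).trans_eq ?_)
    ring

end Probability

/-! ### Bad explorations -/

section Bad

variable {W V : Type*} [Fintype W] [DecidableEq V] {H : SimpleGraph W} [Fintype H.edgeSet]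

variable (H) in
/-- `G` contains the copies of an exploration of length at most `T` that has length `T` or at
least `D` degenerate steps. -/
def HasBadExploration (D T : ℕ) (G : SimpleGraph V) : Prop :=
  ∃ (𝒞 : Set (W ↪ V)) (φ : ℕ → W ↪ V) (b : ℕ → ℕ) (t : ℕ), t ≤ T ∧ IsExploration H 𝒞 φ b t ∧
    (edgesBefore H φ t : Set (Sym2 V)) ⊆ G.edgeSet ∧ (t = T ∨ D ≤ #(degenerateSteps H φ t))

lemma IsExploration.hasContinuation_one {𝒞 : Set (W ↪ V)} {φ : ℕ → W ↪ V} {b : ℕ → ℕ} {t : ℕ}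
    (h : IsExploration H 𝒞 φ b t) {G : SimpleGraph V}
    (hG : (edgesBefore H φ t : Set (Sym2 V)) ⊆ G.edgeSet) :
    HasContinuation H G (t - 1) (fun _ => φ 0) 1 0 #(degenerateSteps H φ t) := by
  classical
  have h1 := h.one_le
  have := h.hasContinuation hG (t - 1) 1 0 (fun _ => φ 0) le_rfl (by omega)
    (fun i hi => by rw [Nat.lt_one_iff.1 hi]) (fun _ _ _ => Nat.zero_le _)
  rwa [filter_true_of_mem] at this
  intro l hl
  exact (mem_Ico.1 (mem_filter.1 hl).1).1

/-- An exploration with many degenerate steps is cut off as soon as it has exactly `D`; the others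
have full length. -/
lemma HasBadExploration.hasContinuation {D T : ℕ} {G : SimpleGraph V}
    (h : HasBadExploration H D T G) :
    ∃ ψ : W ↪ V, (∃ r < D, HasContinuation H G (T - 1) (fun _ => ψ) 1 0 r) ∨
      ∃ m < T, HasContinuation H G m (fun _ => ψ) 1 0 D := by
  obtain ⟨𝒞, φ, b, t, htT, hexp, hG, ht⟩ := h
  refine ⟨φ 0, ?_⟩
  by_cases hD : D ≤ #(degenerateSteps H φ t)
  · obtain ⟨t', h1, h2, rfl⟩ := exists_card_degenerateSteps_eq φ hexp.one_le hD
    refine Or.inr ⟨t' - 1, by omega, (hexp.take h1 h2).hasContinuation_one ?_⟩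
    exact subset_trans (by exact_mod_cast edgesBefore_mono φ h2) hG
  · obtain rfl := ht.resolve_right hD
    exact Or.inl ⟨_, not_le.1 hD, hexp.hasContinuation_one hG⟩

/-- A graph without bad explorations has only small minimal `H`-closed subgraphs. -/
lemma TwoDense.ncard_verts_le (hH : TwoDense H) {D T : ℕ} (hT : 1 ≤ T) {G : SimpleGraph V}
    (hG : ¬ HasBadExploration H D T G) {K F : G.Subgraph} (hK : IsHCore H K)
    (hF : IsMinimalHClosed H K F) :
    F.verts.ncard ≤ (1 + (2 * Fintype.card W + 2) * D) * Fintype.card W := by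
  refine (hF.exists_exploration hH hK D T hT).resolve_right ?_
  rintro ⟨φ, b, t, htT, hexp, ht⟩
  refine hG ⟨_, φ, b, t, htT, hexp, fun x hx => ?_, ht⟩
  obtain ⟨i, hi, hxi⟩ := mem_edgesBefore.1 (mem_coe.1 hx)
  exact F.edgeSet_subset (hexp.mem i hi hxi)

variable [Fintype V]

lemma hasBadExploration_le (p : unitInterval) {q : ℝ} (hq : 0 ≤ q) (hq1 : q ≤ 1) {D T : ℕ}
    (hT : 1 ≤ T)
    (hreg : ∀ (A : Finset (Sym2 V)) (χ : W ↪ V) (S : Finset (W ↪ V)),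
      (∀ ψ ∈ S, ¬ Disjoint (copyEdges H ψ) (copyEdges H χ) ∧ IsRegular A ψ) →
      ∑ ψ ∈ S, (p : ℝ) ^ #(copyEdges H ψ \ A) ≤ 1 / 16)
    (hdeg : ∀ (A : Finset (Sym2 V)) (S : Finset (W ↪ V)), #(edgeVerts A) ≤ T * Fintype.card W →
      (∀ ψ ∈ S, ¬ copyEdges H ψ ⊆ A ∧ ¬ IsRegular A ψ) →
      ∑ ψ ∈ S, (p : ℝ) ^ #(copyEdges H ψ \ A) ≤ q / 16) :
    (SimpleGraph.binomialRandom V p).real {G | HasBadExploration H D T G} ≤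
      (Fintype.card V : ℝ) ^ Fintype.card W * (D * (4 * (1 / 2) ^ T) + 4 * q ^ D) := by
  classical
  have hp0 : (0 : ℝ) ≤ p := p.2.1
  have hp1 : (p : ℝ) ≤ 1 := p.2.2
  have hbound : ∀ (N t r : ℕ) (ψ : W ↪ V), N ≤ T → 1 + t ≤ N →
      (SimpleGraph.binomialRandom V p).real {G | HasContinuation H G t (fun _ => ψ) 1 0 r} ≤
        2 ^ N * (1 / 4) ^ t * q ^ r := by
    intro N t r ψ hN ht
    refine (hasContinuation_le p hq N hreg (fun A S hA hS => hdeg A S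
      (hA.trans (Nat.mul_le_mul_right _ hN)) hS) t _ 1 0 r (by omega) ht).trans ?_
    rw [pow_zero, mul_one]
    exact mul_le_of_le_one_left (by positivity) (pow_le_one₀ hp0 hp1)
  have hlong : ∀ ψ : W ↪ V, (SimpleGraph.binomialRandom V p).real
      (⋃ r ∈ range D, {G | HasContinuation H G (T - 1) (fun _ => ψ) 1 0 r}) ≤
      D * (4 * (1 / 2) ^ T) := by
    intro ψ
    refine (measureReal_biUnion_finset_le _ _).trans ?_
    calc _ ≤ ∑ r ∈ range D, (4 * (1 / 2 : ℝ) ^ T) := by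
          refine sum_le_sum fun r _ => (hbound T (T - 1) r ψ le_rfl (by omega)).trans ?_
          have h1 : (4 : ℝ) * (1 / 2) ^ T = 2 ^ T * (1 / 4) ^ (T - 1) := by
            obtain ⟨T', rfl⟩ : ∃ T', T = T' + 1 := ⟨T - 1, by omega⟩
            rw [Nat.add_sub_cancel, pow_succ, pow_succ, mul_right_comm (2 ^ T' : ℝ), ← mul_pow]
            norm_num
            ring
          rw [h1]
          exact mul_le_of_le_one_right (by positivity) (pow_le_one₀ hq hq1)
      _ = _ := by simp
  have hdegen : ∀ ψ : W ↪ V, (SimpleGraph.binomialRandom V p).real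
      (⋃ m ∈ range T, {G | HasContinuation H G m (fun _ => ψ) 1 0 D}) ≤ 4 * q ^ D := by
    intro ψ
    refine (measureReal_biUnion_finset_le _ _).trans ?_
    calc _ ≤ ∑ m ∈ range T, (2 * q ^ D) * (1 / 2 : ℝ) ^ m := by
          -- The horizon is N = m + 1 rather than T: the factor 2^T would be a power of n, whereas
          -- 2^(m+1) (1/4)^m is summable over m.
          refine sum_le_sum fun m hm => ?_
          have hm' := mem_range.1 hm
          refine (hbound (m + 1) m D ψ (by omega) (by omega)).trans_eq ?_
          rw [pow_succ, mul_right_comm (2 ^ m : ℝ), ← mul_pow]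
          norm_num
          ring
      _ ≤ (2 * q ^ D) * 2 := by
          rw [← mul_sum]
          gcongr
          exact sum_geometric_two_le _
      _ = _ := by ring
  have hsub : {G : SimpleGraph V | HasBadExploration H D T G} ⊆
      ⋃ ψ ∈ (univ : Finset (W ↪ V)),
        ((⋃ r ∈ range D, {G | HasContinuation H G (T - 1) (fun _ => ψ) 1 0 r}) ∪
        ⋃ m ∈ range T, {G | HasContinuation H G m (fun _ => ψ) 1 0 D}) := by
    intro G hG
    obtain ⟨ψ, ⟨r, hr, h⟩ | ⟨m, hm, h⟩⟩ := HasBadExploration.hasContinuation hG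
    · exact Set.mem_biUnion (x := ψ) (mem_coe.2 (mem_univ _))
        (Or.inl (Set.mem_biUnion (x := r) (mem_coe.2 (mem_range.2 hr)) h))
    · exact Set.mem_biUnion (x := ψ) (mem_coe.2 (mem_univ _))
        (Or.inr (Set.mem_biUnion (x := m) (mem_coe.2 (mem_range.2 hm)) h))
  have hcard : (#(univ : Finset (W ↪ V)) : ℝ) ≤ (Fintype.card V : ℝ) ^ Fintype.card W := by
    have := card_embedding_le (∅ : Finset W) (fun _ => (∅ : Finset V))
    simp only [notMem_empty, IsEmpty.forall_iff, implies_true, filter_true, prod_empty, card_empty,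
      one_mul, Nat.sub_zero] at this
    exact_mod_cast this
  refine (measureReal_mono hsub (measure_ne_top _ _)).trans
    ((measureReal_biUnion_finset_le _ _).trans ?_)
  calc _ ≤ ∑ _ψ : W ↪ V, (D * (4 * (1 / 2 : ℝ) ^ T) + 4 * q ^ D) :=
        sum_le_sum fun ψ _ => (measureReal_union_le _ _).trans (add_le_add (hlong ψ) (hdegen ψ))
    _ = #(univ : Finset (W ↪ V)) * (D * (4 * (1 / 2 : ℝ) ^ T) + 4 * q ^ D) := by
        rw [sum_const, nsmul_eq_mul]
    _ ≤ _ := by gcongr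

end Bad

/-! ### Asymptotic estimates -/

section Asymptotics

open Filter Topology

lemma log_two_add_one_le {n : ℕ} (hn : 2 ≤ n) : ((Nat.log 2 n + 1 : ℕ) : ℝ) ≤ 4 * Real.log n := by
  have h0 : (2 : ℝ) ≤ n := by exact_mod_cast hn
  have h1 : Real.log 2 ≤ Real.log n := Real.log_le_log (by norm_num) h0
  have h2 := Real.log_two_gt_d9
  have h3 : (Nat.log 2 n : ℝ) * Real.log 2 ≤ Real.log n := by
    rw [← Real.log_pow]
    refine Real.log_le_log (by positivity) ?_
    exact_mod_cast Nat.pow_log_le_self 2 (by omega)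
  push_cast
  nlinarith [(Nat.cast_nonneg (Nat.log 2 n) : (0 : ℝ) ≤ _)]

/-- Powers of the logarithm are eventually smaller than any positive power. -/
lemma eventually_mul_log_pow_le (C : ℝ) (hC : 0 ≤ C) (v : ℕ) {γ : ℝ} (hγ : 0 < γ) :
    ∀ᶠ n : ℕ in atTop, C * ((Nat.log 2 n + 1 : ℕ) : ℝ) ^ v ≤ (n : ℝ) ^ γ := by
  have h := (isLittleO_log_rpow_rpow_atTop (v : ℝ) hγ).def
    (show 0 < 1 / (C * 4 ^ v + 1) by positivity)
  filter_upwards [tendsto_natCast_atTop_atTop.eventually h, eventually_ge_atTop 2] with n hn h2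
  have hlog := log_two_add_one_le h2
  have hlog0 : 0 ≤ Real.log n := Real.log_natCast_nonneg n
  rw [Real.rpow_natCast, Real.norm_of_nonneg (by positivity),
    Real.norm_of_nonneg (by positivity)] at hn
  calc C * ((Nat.log 2 n + 1 : ℕ) : ℝ) ^ v ≤ C * (4 * Real.log n) ^ v := by gcongr
    _ = C * 4 ^ v * Real.log n ^ v := by ring
    _ ≤ C * 4 ^ v * (1 / (C * 4 ^ v + 1) * (n : ℝ) ^ γ) := by gcongr
    _ = (C * 4 ^ v / (C * 4 ^ v + 1)) * (n : ℝ) ^ γ := by ring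
    _ ≤ 1 * (n : ℝ) ^ γ := by
      gcongr
      rw [div_le_one (by positivity)]
      linarith
    _ = _ := one_mul _

variable {n v e : ℕ} {p c : ℝ}

lemma mul_pow_le_of_le_rpow (hn : 1 ≤ n) (hv : 4 ≤ v) (he : v ≤ e) (hp0 : 0 ≤ p) (hc0 : 0 ≤ c)
    (hc1 : c ≤ 1) (hp : p ≤ c * (n : ℝ) ^ (-1 / (((e : ℝ) - 1) / ((v : ℝ) - 2)))) :
    (n : ℝ) ^ (v - 2) * p ^ (e - 1) ≤ c := by
  have hn0 : (0 : ℝ) < n := by exact_mod_cast hn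
  have hv' : (4 : ℝ) ≤ v := by exact_mod_cast hv
  have he' : (v : ℝ) ≤ e := by exact_mod_cast he
  calc (n : ℝ) ^ (v - 2) * p ^ (e - 1)
      ≤ (n : ℝ) ^ (v - 2) * (c * (n : ℝ) ^ (-1 / (((e : ℝ) - 1) / ((v : ℝ) - 2)))) ^ (e - 1) := by
        gcongr
    _ = (n : ℝ) ^ (v - 2) * (n : ℝ) ^ (-((v : ℝ) - 2)) * c ^ (e - 1) := by
        rw [mul_pow, ← Real.rpow_mul_natCast hn0.le, Nat.cast_sub (by omega), Nat.cast_one]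
        have : -1 / (((e : ℝ) - 1) / ((v : ℝ) - 2)) * ((e : ℝ) - 1) = -((v : ℝ) - 2) := by
          have h1 : (e : ℝ) - 1 ≠ 0 := by linarith
          have h2 : (v : ℝ) - 2 ≠ 0 := by linarith
          field_simp
        rw [this]
        ring
    _ = c ^ (e - 1) := by
        rw [← Real.rpow_natCast, ← Real.rpow_add hn0, Nat.cast_sub (by omega)]
        simp
    _ ≤ c := pow_le_of_le_one hc0 hc1 (by omega)

/-- At p = n^(-(v-2)/(e-1)) the exponent of the left side is ((e-1)(v-s) - (e-x)(v-2))/(e-1), and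
the integer gap makes the numerator at most -1. -/
lemma pow_mul_pow_le_of_le_rpow (hn : 1 ≤ n) (hv : 4 ≤ v) (he : v ≤ e) (hp0 : 0 ≤ p)
    (hp : p ≤ (n : ℝ) ^ (-1 / (((e : ℝ) - 1) / ((v : ℝ) - 2)))) {s x : ℕ} (hs : s ≤ v)
    (hx : x ≤ e) (h : ((e : ℤ) - 1) * (v - s) + 1 ≤ ((e : ℤ) - x) * (v - 2)) :
    p ^ (e - x) * (n : ℝ) ^ (v - s) ≤ (n : ℝ) ^ (-1 / ((e : ℝ) - 1)) := by
  have hn0 : (0 : ℝ) < n := by exact_mod_cast hn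
  have hv' : (4 : ℝ) ≤ v := by exact_mod_cast hv
  have he' : (v : ℝ) ≤ e := by exact_mod_cast he
  have h' : ((e : ℝ) - 1) * (v - s) + 1 ≤ ((e : ℝ) - x) * (v - 2) := by exact_mod_cast h
  calc p ^ (e - x) * (n : ℝ) ^ (v - s)
      ≤ ((n : ℝ) ^ (-1 / (((e : ℝ) - 1) / ((v : ℝ) - 2)))) ^ (e - x) * (n : ℝ) ^ (v - s) := by
        gcongr
    _ = (n : ℝ) ^ (-1 / (((e : ℝ) - 1) / ((v : ℝ) - 2)) * ((e : ℝ) - x) + ((v : ℝ) - s)) := by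
        rw [← Real.rpow_mul_natCast hn0.le, ← Real.rpow_natCast, ← Real.rpow_add hn0,
          Nat.cast_sub hs, Nat.cast_sub hx]
    _ ≤ (n : ℝ) ^ (-1 / ((e : ℝ) - 1)) := by
        refine Real.rpow_le_rpow_of_exponent_le (by exact_mod_cast hn) ?_
        have h1 : 0 < (e : ℝ) - 1 := by linarith
        have h2 : -1 / (((e : ℝ) - 1) / ((v : ℝ) - 2)) * ((e : ℝ) - x) + ((v : ℝ) - s) =
            (-(((e : ℝ) - x) * (v - 2)) + ((e : ℝ) - 1) * (v - s)) / ((e : ℝ) - 1) := by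
          field_simp
        rw [h2, div_le_div_iff_of_pos_right h1]
        linarith

end Asymptotics

/-! ### Choice of constants and conclusion -/

section Main

open Filter Topology

variable {W : Type*} [Fintype W] {H : SimpleGraph W} [Fintype H.edgeSet]

/-- There are at most n^v starting copies, so `T` and `D` are chosen to make both 2^(-T) and q^D at
most n^(-(v+1)). The constant 1/(16 v^4) brings the regular attachments down to 1/16. -/
lemma TwoDense.eventually_hasBadExploration_le (hH : TwoDense H) :
    ∀ᶠ n : ℕ in atTop, ∀ p : unitInterval,
      (p : ℝ) ≤ 1 / (16 * (Fintype.card W : ℝ) ^ 4) *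
        (n : ℝ) ^ (-1 / (((#H.edgeFinset : ℝ) - 1) / ((Fintype.card W : ℝ) - 2))) →
      (SimpleGraph.binomialRandom (Fin n) p).real {G | HasBadExploration H
        (2 * (Fintype.card W + 1) * (#H.edgeFinset - 1))
        ((Fintype.card W + 1) * (Nat.log 2 n + 1)) G} ≤
      (4 * (2 * (Fintype.card W + 1) * (#H.edgeFinset - 1) : ℕ) + 4) * (n : ℝ)⁻¹ := by
  have hv := hH.four_le
  have he := hH.card_le
  set v := Fintype.card W with hvdef
  set e := #H.edgeFinset with hedef
  set D := 2 * (v + 1) * (e - 1) with hD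
  have hv' : (4 : ℝ) ≤ v := by exact_mod_cast hv
  have he' : (v : ℝ) ≤ e := by exact_mod_cast he
  have he1 : (0 : ℝ) < e - 1 := by linarith
  -- Half of the exponent 1/(e-1) is sacrificed to absorb the powers of log n; the factor 2 in `D`
  -- makes up for it.
  have hγ : 0 < 1 / (2 * ((e : ℝ) - 1)) := by positivity
  filter_upwards [eventually_mul_log_pow_le (16 * (2 ^ v * ((v + 1) * v : ℝ) ^ v))
    (by positivity) v hγ, eventually_ge_atTop 1] with n hn hn1 p hp
  have hn1' : (1 : ℝ) ≤ n := by exact_mod_cast hn1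
  have hn0 : (0 : ℝ) < n := by linarith
  set T := (v + 1) * (Nat.log 2 n + 1) with hT
  have hT1 : 1 ≤ T := Nat.mul_pos (by omega) (by omega)
  set η : ℝ := (n : ℝ) ^ (-1 / ((e : ℝ) - 1)) with hη
  have hη0 : 0 ≤ η := by positivity
  set q : ℝ := 16 * (2 ^ v * ((T * v : ℕ) : ℝ) ^ v * η) with hq
  have hq0 : 0 ≤ q := by positivity
  have hqle : q ≤ (n : ℝ) ^ (-(1 / (2 * ((e : ℝ) - 1)))) := by
    calc q = 16 * (2 ^ v * ((v + 1) * v : ℝ) ^ v) * ((Nat.log 2 n + 1 : ℕ) : ℝ) ^ v * η := by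
          rw [hq, hT]
          push_cast
          rw [mul_right_comm ((v : ℝ) + 1), mul_pow _ ((Nat.log 2 n : ℝ) + 1)]
          ring
      _ ≤ (n : ℝ) ^ (1 / (2 * ((e : ℝ) - 1))) * η := by gcongr
      _ = _ := by
          rw [hη, ← Real.rpow_add hn0]
          congr 1
          field_simp
          norm_num
  have hq1 : q ≤ 1 := hqle.trans (Real.rpow_le_one_of_one_le_of_nonpos hn1' (by linarith))
  have hp0 : (0 : ℝ) ≤ p := p.2.1
  have hc1 : 1 / (16 * (v : ℝ) ^ 4) ≤ 1 := by
    rw [div_le_one (by positivity)]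
    have : (1 : ℝ) ≤ (v : ℝ) ^ 4 := one_le_pow₀ (by linarith)
    linarith
  have hmain := hasBadExploration_le (H := H) (V := Fin n) p hq0 hq1 (D := D) hT1
    (fun A χ S hS => by
      refine (sum_regular_le hp0 p.2.2 χ S hS).trans ?_
      rw [Fintype.card_fin]
      calc _ ≤ (v : ℝ) ^ 4 * (1 / (16 * (v : ℝ) ^ 4)) := by
            gcongr
            exact mul_pow_le_of_le_rpow hn1 hv he hp0 (by positivity) hc1 hp
        _ = 1 / 16 := by field_simp)
    (fun A S hA hS => by
      have := hH.sum_degenerate_le (p := p) (A := A) hη0 (by rwa [Fintype.card_fin])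
        (Nat.mul_pos hT1 (by omega)) hA (fun s x hs hx h => by
          rw [Fintype.card_fin]
          exact pow_mul_pow_le_of_le_rpow hn1 hv he hp0
            (hp.trans (mul_le_of_le_one_left (by positivity) hc1)) hs hx h) S hS
      refine this.trans_eq ?_
      rw [hq]
      ring)
  refine hmain.trans ?_
  rw [Fintype.card_fin, mul_add, add_mul]
  refine add_le_add ?_ ?_
  · have hpow : (n : ℝ) ^ (v + 1) ≤ 2 ^ T := by
      rw [hT, mul_comm, pow_mul]
      gcongr
      exact_mod_cast (Nat.lt_pow_succ_log_self (by norm_num) n).le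
    calc (n : ℝ) ^ v * (D * (4 * (1 / 2) ^ T)) = 4 * D * ((n : ℝ) ^ v / 2 ^ T) := by
          rw [one_div, inv_pow]
          ring
      _ ≤ 4 * D * ((n : ℝ) ^ v / (n : ℝ) ^ (v + 1)) := by gcongr
      _ = _ := by
          rw [pow_succ]
          field_simp
  · have hpow : q ^ D ≤ (n : ℝ) ^ (-((v : ℝ) + 1)) := by
      calc q ^ D ≤ ((n : ℝ) ^ (-(1 / (2 * ((e : ℝ) - 1))))) ^ D := by gcongr
        _ = _ := by
          rw [← Real.rpow_mul_natCast hn0.le, hD]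
          congr 1
          push_cast [Nat.cast_sub (by omega : 1 ≤ e)]
          field_simp
    calc (n : ℝ) ^ v * (4 * q ^ D) ≤ (n : ℝ) ^ v * (4 * (n : ℝ) ^ (-((v : ℝ) + 1))) := by gcongr
      _ = 4 * ((n : ℝ) ^ (v : ℝ) * (n : ℝ) ^ (-((v : ℝ) + 1))) := by
          rw [Real.rpow_natCast]
          ring
      _ = 4 * (n : ℝ)⁻¹ := by
          rw [← Real.rpow_add hn0, ← Real.rpow_neg_one]
          congr 2
          ring

end Main

end HCore

theorem lemma5p4 {W : Type*} [Finite W] (H : SimpleGraph W)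
    (hbal : HCore.IsStrictlyTwoBalanced H) (hforest : ¬ H.IsAcyclic)
    (htriangle : ¬ Nonempty (H ≃g (⊤ : SimpleGraph (Fin 3)))) :
    ∃ c : ℝ, 0 < c ∧ ∃ L : ℕ, 0 < L ∧
      ∀ p : ℕ → unitInterval,
        (∀ᶠ n : ℕ in Filter.atTop, (p n : ℝ) ≤ c * (n : ℝ) ^ (-1 / HCore.m2 H)) →
        Filter.Tendsto
          (fun n : ℕ => SimpleGraph.binomialRandom (Fin n) (p n)
            {G | ∀ K : G.Subgraph, HCore.IsHCore H K →
              ∀ F : G.Subgraph, HCore.IsMinimalHClosed H K F → F.verts.ncard ≤ L})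
          Filter.atTop (nhds 1) := by
  classical
  cases nonempty_fintype W
  have hH : HCore.TwoDense H := hbal.twoDense hforest htriangle
  have hv := hH.four_le
  have hm : HCore.m2 H = ((#H.edgeFinset : ℝ) - 1) / ((Fintype.card W : ℝ) - 2) := by
    rw [hbal.2.1, HCore.d2, Nat.card_eq_fintype_card, ← SimpleGraph.coe_edgeFinset,
      Set.ncard_coe_finset]
  set D := 2 * (Fintype.card W + 1) * (#H.edgeFinset - 1) with hD
  refine ⟨1 / (16 * (Fintype.card W : ℝ) ^ 4), by positivity,
    (1 + (2 * Fintype.card W + 2) * D) * Fintype.card W, Nat.mul_pos (by omega) (by omega),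
    fun p hp => ?_⟩
  rw [hm] at hp
  have hlim : Filter.Tendsto (fun n : ℕ => 1 - ENNReal.ofReal ((4 * (D : ℝ) + 4) * (n : ℝ)⁻¹))
      Filter.atTop (nhds 1) := by
    have h1 : Filter.Tendsto (fun n : ℕ => (4 * (D : ℝ) + 4) * (n : ℝ)⁻¹) Filter.atTop
        (nhds 0) := by
      simpa using (tendsto_inv_atTop_nhds_zero_nat (𝕜 := ℝ)).const_mul (4 * (D : ℝ) + 4)
    have h2 := ENNReal.tendsto_ofReal h1
    rw [ENNReal.ofReal_zero] at h2
    simpa using ENNReal.Tendsto.sub (tendsto_const_nhds (x := (1 : ENNReal))) h2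
      (Or.inl ENNReal.one_ne_top)
  refine tendsto_of_tendsto_of_tendsto_of_le_of_le' hlim tendsto_const_nhds ?_
    (Filter.Eventually.of_forall fun n => prob_le_one)
  filter_upwards [hp, hH.eventually_hasBadExploration_le] with n hpn hbad
  have hb := hbad (p n) hpn
  rw [← hD] at hb
  set T := (Fintype.card W + 1) * (Nat.log 2 n + 1)
  have hT : 1 ≤ T := Nat.mul_pos (by omega) (by omega)
  set S := {G : SimpleGraph (Fin n) | ∀ K : G.Subgraph, HCore.IsHCore H K →
    ∀ F : G.Subgraph, HCore.IsMinimalHClosed H K F →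
      F.verts.ncard ≤ (1 + (2 * Fintype.card W + 2) * D) * Fintype.card W}
  -- Covering the whole space by the two events and using subadditivity avoids measurability
  -- questions.
  have hcover : (Set.univ : Set (SimpleGraph (Fin n))) ⊆
      S ∪ {G | HCore.HasBadExploration H D T G} := by
    intro G _
    by_cases hG : HCore.HasBadExploration H D T G
    · exact Or.inr hG
    · exact Or.inl fun K hK F hF => hH.ncard_verts_le hT hG hK hF
  have hle := (measure_mono (μ := SimpleGraph.binomialRandom (Fin n) (p n)) hcover).trans
    (measure_union_le _ _)
  rw [measure_univ] at hle
  rw [tsub_le_iff_right]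
  refine hle.trans (add_le_add le_rfl ?_)
  rw [← ENNReal.ofReal_toReal (measure_ne_top _ {G | HCore.HasBadExploration H D T G})]
  exact ENNReal.ofReal_le_ofReal hb
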